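/- **Setting.** For each index $n$ (a sequence, an array indexed by $(r,c)$, or more generally any index set with a filter along which $r\to\infty$ and $c\to\infty$; the dependence on $n$ is suppressed) consider an $r\times c$ two-way layout with cell counts $K_{ij}\in\{0,1,2,\dots\}$, set of non-empty cells $\mathcal E=\{(i,j):K_{ij}\ge 1\}$, and fixed cell means $\eta_{ij}=\mu+\alpha_i+\beta_j$. One observes independent $y_{ij}\sim N(\eta_{ij},\sigma^2/K_{ij})$, $(i,j)\in\mathcal E$, with $\sigma>0$ known and fixed. Write $\eta_c=(\eta_{ij})_{i\le r,\,j\le c}$, $\eta=(\eta_{ij})_{(i,j)\in\mathcal E}$ and $M=\mathrm{diag}(K_{ij}^{-1})_{(i,j)\in\mathcal E}$. Let $Z_c=[Z_A\ Z_B]$ be the $rc\times(r+c)$ incidence matrix of cells with rows and columns of the layout, let $Z$ consist of the rows of $Z_c$ belonging to $\mathcal E$, and let $Z^\dagger$ be its Moore–Penrose inverse. For $h=(m,\lambda_A,\lambda_B)\in\mathbb R\times[0,\infty]^2$ let $\Lambda=\mathrm{diag}(\sqrt{\lambda_A}\,I_r,\sqrt{\lambda_B}\,I_c)$, $\Sigma=Z\Lambda\Lambda^{T}Z^{T}+M$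 ($\Sigma^{-1}$ is extended to infinite $\lambda_A,\lambda_B$ by continuity) and $$\hat\eta^{S}(h)=y-M\Sigma^{-1}(y-m\mathbf 1),\qquad \hat\eta^{S}_c(h)=Z_cZ^\dagger\hat\eta^{S}(h).$$ Let $L(\eta_c,x)=(rc)^{-1}\|x-\eta_c\|^2$ for $x\in\mathbb R^{rc}$, $Q=(Z_cZ^\dagger)^{T}Z_cZ^\dagger$, $L^Q(\eta,x)=(rc)^{-1}(x-\eta)^{T}Q(x-\eta)$ for $x\in\mathbb R^{\mathcal E}$, and $$\mathrm{URE}^Q(h)=\frac1{rc}\Big\{\sigma^2\,\mathrm{tr}(QM)-2\sigma^2\,\mathrm{tr}(\Sigma^{-1}MQM)+(y-m\mathbf 1)^{T}\Sigma^{-1}MQM\Sigma^{-1}(y-m\mathbf 1)\Big\}.$$ Fix $\tau\in(0,1]$ and let $\hat T=[\hat a_\tau,\hat b_\tau]\times[0,\infty]\times[0,\infty]$, where $\hat a_\tau,\hat b_\tau$ are the $\tau/2$ and $1-\tau/2$ sample quantiles of the observations (the $q$-quantile being the least $x$ such that at least a proportion $q$ of the observations is $\le x$). Let $\hat h^{URE}$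 be any measurable choice of a minimizer of $\mathrm{URE}^Q$ over $\hat T$, and $\tilde h^{OL}$ any measurable choice of a minimizer of $h\mapsto L^Q(\eta,\hat\eta^{S}(h))$ over $\hat T$; put $\hat\eta_c^{URE}=\hat\eta_c^{S}(\hat h^{URE})$ and $\tilde\eta_c^{OL}=\hat\eta_c^{S}(\tilde h^{OL})$. **Assumptions.** A1. $\eta_c$ is estimable, i.e. $Z_c=AZ$ for some matrix $A$, and $(rc)^{-1}\sum_{i,j}\eta_{ij}^2$ stays bounded as $r,c\to\infty$. A2. $(rc)^{-1/8}(\log(rc))^2\,\nu_{r,c}\,\lambda_1(Q)\to0$ as $r,c\to\infty$, where $\nu_{r,c}=\max_{\mathcal E}K_{ij}/\min_{\mathcal E}K_{ij}$ and $\lambda_1(Q)$ is the largest eigenvalue of $Q$. **Theorem.** Under A1–A2, $L(\eta_c,\hat\eta_c^{URE})$ and $L(\eta_c,\tilde\eta_c^{OL})$ are integrable, and $$\mathbb E\,L(\eta_c,\hat\eta_c^{URE})-\mathbb E\,L(\eta_c,\tilde\eta_c^{OL})\longrightarrow 0\qquad\text{as } r,c\to\infty .$$ -/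

import Mathlib

open MeasureTheory ProbabilityTheory Filter Topology
open scoped ENNReal NNReal Matrix

namespace TwoWay

/-! ### Linear algebra -/

/-- The four Penrose equations: `X` is the Moore-Penrose inverse of the real matrix `A`. -/
structure IsMoorePenrose {m n : Type*} [Fintype m] [Fintype n]
    (A : Matrix m n ℝ) (X : Matrix n m ℝ) : Prop where
  mul_mul : A * X * A = A
  mul_mul' : X * A * X = X
  symm_left : (A * X)ᵀ = A * X
  symm_right : (X * A)ᵀ = X * A

/-- The spectral inverse of `AᵀA`: its nonzero eigenvalues are inverted, zero stays zero. -/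
noncomputable def gramPinv {m n : Type*} [Fintype m] [Fintype n] [DecidableEq n]
    (A : Matrix m n ℝ) : Matrix n n ℝ :=
  ((Matrix.isHermitian_conjTranspose_mul_self A).eigenvectorUnitary : Matrix n n ℝ) *
    Matrix.diagonal (fun i => ((Matrix.isHermitian_conjTranspose_mul_self A).eigenvalues i)⁻¹) *
    ((Matrix.isHermitian_conjTranspose_mul_self A).eigenvectorUnitary : Matrix n n ℝ)ᵀ

/-- The Moore-Penrose inverse `A† = (AᵀA)† Aᵀ` of a real matrix
(see `isMoorePenrose_pinv` and `IsMoorePenrose.eq`). -/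
noncomputable def pinv {m n : Type*} [Fintype m] [Fintype n] [DecidableEq n]
    (A : Matrix m n ℝ) : Matrix n m ℝ :=
  gramPinv A * Aᵀ

theorem isMoorePenrose_pinv {m n : Type*} [Fintype m] [Fintype n] [DecidableEq n]
    (A : Matrix m n ℝ) : IsMoorePenrose A (pinv A) := by
  set hA := Matrix.isHermitian_conjTranspose_mul_self A with hAdef
  set U : Matrix n n ℝ := (hA.eigenvectorUnitary : Matrix n n ℝ) with hU
  have hUU : Uᵀ * U = 1 := by
    have := Unitary.coe_star_mul_self hA.eigenvectorUnitary
    rwa [Matrix.star_eq_conjTranspose, Matrix.conjTranspose_eq_transpose_of_trivial] at this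
  have hUU' : U * Uᵀ = 1 := mul_eq_one_comm.mp hUU
  have hspec : Aᵀ * A = U * Matrix.diagonal hA.eigenvalues * Uᵀ := by
    have h := hA.spectral_theorem
    rw [Unitary.conjStarAlgAut_apply] at h
    exact h
  have hG : gramPinv A = U * Matrix.diagonal (fun i => (hA.eigenvalues i)⁻¹) * Uᵀ := rfl
  have hGt : (gramPinv A)ᵀ = gramPinv A := by
    rw [hG]; simp [Matrix.transpose_mul, Matrix.mul_assoc]
  have prodU : ∀ d e : n → ℝ, U * Matrix.diagonal d * Uᵀ * (U * Matrix.diagonal e * Uᵀ)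
      = U * Matrix.diagonal (fun i => d i * e i) * Uᵀ := by
    intro d e
    calc U * Matrix.diagonal d * Uᵀ * (U * Matrix.diagonal e * Uᵀ)
        = U * Matrix.diagonal d * (Uᵀ * U) * Matrix.diagonal e * Uᵀ := by
          simp only [Matrix.mul_assoc]
      _ = _ := by rw [hUU, Matrix.mul_one, Matrix.mul_assoc U, Matrix.diagonal_mul_diagonal]
  have hx1 : ∀ x : ℝ, x * (x⁻¹ * x) = x := fun x => by
    by_cases h : x = 0 <;> simp [h]
  have hx2 : ∀ x : ℝ, x⁻¹ * x * x⁻¹ = x⁻¹ := fun x => by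
    by_cases h : x = 0 <;> simp [h]
  have h1 : (Aᵀ * A) * (gramPinv A * (Aᵀ * A)) = Aᵀ * A := by
    rw [hspec, hG, prodU, prodU]
    congr 3; funext i
    exact hx1 _
  have h2 : gramPinv A * (Aᵀ * A) * gramPinv A = gramPinv A := by
    rw [hspec, hG, prodU, prodU]
    congr 3; funext i
    exact hx2 _
  have h3 : (gramPinv A * (Aᵀ * A))ᵀ = gramPinv A * (Aᵀ * A) := by
    rw [hspec, hG, prodU]; simp [Matrix.transpose_mul, Matrix.mul_assoc]
  have h4 : A * (gramPinv A * (Aᵀ * A)) = A := by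
    have : Aᴴ * A * (gramPinv A * (Aᵀ * A) - 1) = 0 := by
      rw [Matrix.conjTranspose_eq_transpose_of_trivial, Matrix.mul_sub, h1, Matrix.mul_one,
        sub_self]
    rw [Matrix.conjTranspose_mul_self_mul_eq_zero, Matrix.mul_sub, Matrix.mul_one,
      sub_eq_zero] at this
    exact this
  refine ⟨?_, ?_, ?_, ?_⟩
  · simpa only [pinv, Matrix.mul_assoc] using h4
  · calc pinv A * A * pinv A = gramPinv A * (Aᵀ * A) * gramPinv A * Aᵀ := by
          simp only [pinv, Matrix.mul_assoc]
      _ = pinv A := by rw [h2]; rfl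
  · simp [pinv, Matrix.transpose_mul, hGt, Matrix.mul_assoc]
  · simpa only [pinv, Matrix.mul_assoc] using h3

/-- The Penrose equations determine the Moore-Penrose inverse. -/
theorem IsMoorePenrose.eq {m n : Type*} [Fintype m] [Fintype n]
    {A : Matrix m n ℝ} {X Y : Matrix n m ℝ} (hX : IsMoorePenrose A X) (hY : IsMoorePenrose A Y) :
    X = Y := by
  have e1 : A * X = A * Y := by
    calc A * X = (A * X)ᵀ := hX.symm_left.symm
      _ = ((A * Y) * (A * X))ᵀ := by rw [← Matrix.mul_assoc, hY.mul_mul]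
      _ = (A * X) * (A * Y) := by rw [Matrix.transpose_mul, hX.symm_left, hY.symm_left]
      _ = A * Y := by rw [← Matrix.mul_assoc, hX.mul_mul]
  have e2 : X * A = Y * A := by
    calc X * A = (X * A)ᵀ := hX.symm_right.symm
      _ = ((X * A) * (Y * A))ᵀ := by
          rw [Matrix.mul_assoc X, ← Matrix.mul_assoc A, hY.mul_mul]
      _ = (Y * A) * (X * A) := by rw [Matrix.transpose_mul, hX.symm_right, hY.symm_right]
      _ = Y * A := by rw [Matrix.mul_assoc Y, ← Matrix.mul_assoc A, hX.mul_mul]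
  calc X = X * A * X := hX.mul_mul'.symm
    _ = Y * A * Y := by rw [e2, Matrix.mul_assoc, e1, Matrix.mul_assoc]
    _ = Y := hY.mul_mul'

/-- The largest eigenvalue of a symmetric real matrix (`0` for the empty matrix). -/
noncomputable def lambdaMax {n : Type*} [Fintype n] [DecidableEq n] (A : Matrix n n ℝ) : ℝ :=
  sSup (spectrum ℝ A)

/-! ### The additive model -/

variable {r c : ℕ}

/-- The non-empty cells; `K p` is the number of observations in cell `p`. -/
abbrev Obs (K : Fin r × Fin c → ℕ) : Type := {p : Fin r × Fin c // 0 < K p}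

/-- The cell means `η_{ij} = μ + α_i + β_j`. -/
def cellMean (μ : ℝ) (α : Fin r → ℝ) (β : Fin c → ℝ) : Fin r × Fin c → ℝ :=
  fun p => μ + α p.1 + β p.2

/-- The design matrix `Z_c = [Z_A Z_B]` of the complete two-way layout. -/
def designC (r c : ℕ) : Matrix (Fin r × Fin c) (Fin r ⊕ Fin c) ℝ :=
  Matrix.of fun p => Sum.elim (fun i => if p.1 = i then 1 else 0) (fun j => if p.2 = j then 1 else 0)

/-- The design matrix `Z`: the rows of `Z_c` that belong to non-empty cells. -/
def design (K : Fin r × Fin c → ℕ) : Matrix (Obs K) (Fin r ⊕ Fin c) ℝ :=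
  (designC r c).submatrix Subtype.val id

/-- All `rc` cell means are estimable from the non-empty cells: they are linear functions of the
means of the non-empty cells. -/
def Estimable (K : Fin r × Fin c → ℕ) : Prop :=
  ∃ A : Matrix (Fin r × Fin c) (Obs K) ℝ, A * design K = designC r c

/-- `M = diag(1 / K_{ij})`. -/
noncomputable def errCov (K : Fin r × Fin c → ℕ) : Matrix (Obs K) (Obs K) ℝ :=
  Matrix.diagonal fun p => (K p : ℝ)⁻¹

/-- The law `N(η, σ² M)` of the observations: independent `y_{ij} ~ N(η_{ij}, σ² / K_{ij})` over
the non-empty cells, where `η` lists all cell means. -/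
noncomputable def obsLaw (K : Fin r × Fin c → ℕ) (σ : ℝ) (η : Fin r × Fin c → ℝ) :
    Measure (Obs K → ℝ) :=
  Measure.pi fun p => gaussianReal (η p) (Real.toNNReal (σ ^ 2 / K p))

/-! ### The shrinkage estimators -/

/-- `Λ = diag(√λ_A I_r, √λ_B I_c)`. -/
noncomputable def scaleMat (r c : ℕ) (a b : ℝ) : Matrix (Fin r ⊕ Fin c) (Fin r ⊕ Fin c) ℝ :=
  Matrix.diagonal (Sum.elim (fun _ => √a) (fun _ => √b))

/-- `Σ = Z Λ Λᵀ Zᵀ + M` for finite scales `λ_A = a`, `λ_B = b`. -/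
noncomputable def margCov (K : Fin r × Fin c → ℕ) (a b : ℝ) : Matrix (Obs K) (Obs K) ℝ :=
  design K * scaleMat r c a b * (scaleMat r c a b)ᵀ * (design K)ᵀ + errCov K

/-- `Σ⁻¹` as a function of `(λ_A, λ_B) ∈ [0, ∞]²`: the matrix inverse at finite scales, and its
continuous extension (the limit along finite scales) when a scale is infinite. -/
noncomputable def margPrec (K : Fin r × Fin c → ℕ) : ℝ≥0∞ × ℝ≥0∞ → Matrix (Obs K) (Obs K) ℝ :=
  extendFrom {s : ℝ≥0∞ × ℝ≥0∞ | s.1 ≠ ∞ ∧ s.2 ≠ ∞}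
    (fun s => (margCov K s.1.toReal s.2.toReal)⁻¹)

/-- At finite scales, `margPrec` is the inverse of `margCov`. -/
theorem margPrec_of_finite (K : Fin r × Fin c → ℕ) (s : ℝ≥0∞ × ℝ≥0∞)
    (hs : s.1 ≠ ∞ ∧ s.2 ≠ ∞) :
    margPrec K s = (margCov K s.1.toReal s.2.toReal)⁻¹ := by
  refine extendFrom_eq (subset_closure hs) ?_
  have hM : (errCov K).PosDef := Matrix.PosDef.diagonal fun p => by
    have := p.2
    positivity
  have hdet : (margCov K s.1.toReal s.2.toReal).det ≠ 0 := by
    have hS : (margCov K s.1.toReal s.2.toReal).PosDef := by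
      have h0 := Matrix.posSemidef_self_mul_conjTranspose
        (design K * scaleMat r c s.1.toReal s.2.toReal)
      rw [Matrix.conjTranspose_eq_transpose_of_trivial, Matrix.transpose_mul] at h0
      have := hM.posSemidef_add h0
      simpa only [margCov, Matrix.mul_assoc] using this
    exact hS.det_pos.ne'
  have h1 : ContinuousAt (fun t : ℝ≥0∞ × ℝ≥0∞ => t.1.toReal) s :=
    (ENNReal.tendsto_toReal hs.1).comp continuousAt_fst
  have h2 : ContinuousAt (fun t : ℝ≥0∞ × ℝ≥0∞ => t.2.toReal) s :=
    (ENNReal.tendsto_toReal hs.2).comp continuousAt_snd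
  have hcov : Continuous fun q : ℝ × ℝ => margCov K q.1 q.2 := by
    have hsc : Continuous fun q : ℝ × ℝ => scaleMat r c q.1 q.2 := by
      refine Continuous.matrix_diagonal (continuous_pi fun i => ?_)
      cases i <;> simp <;> fun_prop
    unfold margCov
    fun_prop
  have hc : ContinuousAt (fun t : ℝ≥0∞ × ℝ≥0∞ => margCov K t.1.toReal t.2.toReal) s :=
    hcov.continuousAt.comp (f := fun t : ℝ≥0∞ × ℝ≥0∞ => (t.1.toReal, t.2.toReal)) (h1.prodMk h2)
  have hinv : ContinuousAt (fun B : Matrix (Obs K) (Obs K) ℝ => B⁻¹)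
      (margCov K s.1.toReal s.2.toReal) := by
    simp only [Matrix.inv_def, Ring.inverse_eq_inv']
    exact (continuous_id.matrix_det.continuousAt.inv₀ hdet).smul
      continuous_id.matrix_adjugate.continuousAt
  exact (hinv.tendsto.comp hc.tendsto).mono_left nhdsWithin_le_nhds

/-- A hyper-parameter `(μ, λ_A, λ_B) ∈ ℝ × [0, ∞] × [0, ∞]`. -/
abbrev Hyper : Type := ℝ × ℝ≥0∞ × ℝ≥0∞

/-- The shrinkage estimator `y - M Σ⁻¹ (y - μ 1)` of the means of the non-empty cells. -/
noncomputable def shrink (K : Fin r × Fin c → ℕ) (y : Obs K → ℝ) (h : Hyper) : Obs K → ℝ :=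
  y - (errCov K * margPrec K h.2) *ᵥ (y - fun _ => h.1)

/-- `Z_c Z†`, which carries the means of the non-empty cells to the means of all cells. -/
noncomputable def completeMat (K : Fin r × Fin c → ℕ) : Matrix (Fin r × Fin c) (Obs K) ℝ :=
  designC r c * pinv (design K)

/-- The estimator `Z_c Z† (y - M Σ⁻¹ (y - μ 1))` of all cell means. -/
noncomputable def shrinkC (K : Fin r × Fin c → ℕ) (y : Obs K → ℝ) (h : Hyper) :
    Fin r × Fin c → ℝ :=
  completeMat K *ᵥ shrink K y h

/-- `Q = (Z_c Z†)ᵀ Z_c Z†`. -/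
noncomputable def lossMat (K : Fin r × Fin c → ℕ) : Matrix (Obs K) (Obs K) ℝ :=
  (completeMat K)ᵀ * completeMat K

/-- The normalized sum-of-squares loss over all `rc` cells. -/
noncomputable def loss (η x : Fin r × Fin c → ℝ) : ℝ :=
  ((r : ℝ) * c)⁻¹ * ∑ p, (x p - η p) ^ 2

/-- The loss `L^Q(η, x) = (rc)⁻¹ (x - η)ᵀ Q (x - η)` over the non-empty cells. -/
noncomputable def lossQ (K : Fin r × Fin c → ℕ) (η x : Obs K → ℝ) : ℝ :=
  ((r : ℝ) * c)⁻¹ * ((x - η) ⬝ᵥ (lossMat K *ᵥ (x - η)))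

/-- The unbiased risk estimate of the shrinkage estimator with respect to `L^Q`:
`(rc)⁻¹ {σ² tr(QM) - 2σ² tr(Σ⁻¹MQM) + (y - μ1)ᵀ Σ⁻¹MQMΣ⁻¹ (y - μ1)}`. -/
noncomputable def ure (K : Fin r × Fin c → ℕ) (σ : ℝ) (y : Obs K → ℝ) (h : Hyper) : ℝ :=
  ((r : ℝ) * c)⁻¹ *
    (σ ^ 2 * (lossMat K * errCov K).trace
      - 2 * σ ^ 2 * (margPrec K h.2 * errCov K * lossMat K * errCov K).trace
      + (y - fun _ => h.1) ⬝ᵥ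
          ((margPrec K h.2 * errCov K * lossMat K * errCov K * margPrec K h.2) *ᵥ
            (y - fun _ => h.1)))

/-! ### Tuning -/

/-- The sample `q`-quantile of a finite family of reals: the least `x` such that at least a
proportion `q` of the family is at most `x`. -/
noncomputable def quantile {κ : Type*} [Fintype κ] (y : κ → ℝ) (q : ℝ) : ℝ :=
  sInf {x : ℝ | q ≤ (Nat.card {k : κ // y k ≤ x} : ℝ) / Fintype.card κ}

/-- The data-dependent range `[â_τ, b̂_τ] × [0, ∞] × [0, ∞]` of the hyper-parameter, where `â_τ`
and `b̂_τ` are the `τ/2` and `1 - τ/2` quantiles of the observations. -/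
noncomputable def hyperRange {K : Fin r × Fin c → ℕ} (τ : ℝ) (y : Obs K → ℝ) : Set Hyper :=
  {h | h.1 ∈ Set.Icc (quantile y (τ / 2)) (quantile y (1 - τ / 2))}

/-- `hyp` is a (measurable) choice, for each data vector `y`, of a minimizer of the objective
`obj y` over the range of the hyper-parameter. -/
structure IsTuning {K : Fin r × Fin c → ℕ} (τ : ℝ) (obj : (Obs K → ℝ) → Hyper → ℝ)
    (hyp : (Obs K → ℝ) → Hyper) : Prop where
  measurable : Measurable hyp
  mem : ∀ y, hyp y ∈ hyperRange τ y
  isMinOn : ∀ y, IsMinOn (obj y) (hyperRange τ y) (hyp y)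

/-- The hyper-parameters tuned by minimizing the unbiased risk estimate. -/
def IsURETuning (K : Fin r × Fin c → ℕ) (σ τ : ℝ) (hyp : (Obs K → ℝ) → Hyper) : Prop :=
  IsTuning τ (ure K σ) hyp

/-- The oracle-loss hyper-parameters, which minimize the actual loss `L^Q`. -/
def IsOracleTuning (K : Fin r × Fin c → ℕ) (τ : ℝ) (η : Fin r × Fin c → ℝ)
    (hyp : (Obs K → ℝ) → Hyper) : Prop :=
  IsTuning τ (fun y h => lossQ K (fun p => η p) (shrink K y h)) hyp

/-! ### Assumptions on the design -/

/-- `ν_{r,c}`: the largest over the smallest number of observations in the non-empty cells. -/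
noncomputable def imbalance (K : Fin r × Fin c → ℕ) : ℝ :=
  (⨆ p : Obs K, (K p : ℝ)) / (⨅ p : Obs K, (K p : ℝ))

end TwoWay

/-!
Write `x` for the standardized noise, `W = M^{1/2} Σ⁻¹ M^{1/2}` and `T = M^{1/2} Q M^{1/2}`. Up to a
term that does not involve the hyper-parameter, `URE - L^Q` is `2 / (rc)` times
`σ² (xᵀ T W x - tr (T W)) + σ xᵀ T W w - σ m xᵀ T W w'`, where `w = M^{-1/2} η`, `w' = M^{-1/2} 1` and
`m` is the location parameter (`ure_sub_lossQ`). Since the oracle minimizes the loss and the other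
rule minimizes its unbiased risk estimate, the difference of the two risks lies between zero and
twice the expected supremum of the absolute value of this expression (`abs_risk_sub_le`).
Estimability identifies the loss over all cells with `L^Q` (`loss_shrinkC_eq_lossQ`).

The supremum over `(λ_A, λ_B) ∈ [0, ∞]²` is handled by bracketing in the Loewner order. The matrix
`W` satisfies `0 ≤ W ≤ 1`, extends continuously to infinite scales, and decreases in both scales.
Moving `λ_B` over all of `[0, ∞]` changes `W` by a matrix of rank at most `c`, hence of trace at most
`c`; moving `λ_A` changes the trace by at most `r`. The scale whose block has the smaller rank is
therefore left free within a bracket, at a cost of `min (r, c) ≤ √(rc)`, and the other one is cut by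
the intermediate value theorem into `J` intervals along which the trace drops by at most `rc / J`
(`exists_isBracketing`). No bound on the eigenvalues of the design is needed.

Within a bracket, the Cauchy-Schwarz inequality for `0 ≤ Δ ≤ hi - lo` bounds `xᵀ T Δ z` by quadratic
forms in the width `hi - lo`, whose expectations are controlled by its trace. The fluctuations of
the finitely many remaining quadratic forms are summed in mean square by Isserlis' formula
(`integral_quad_sub_trace_sq_le`). The location parameter lies between two non-extreme quantiles, so
it is at most of the order of the root mean square of the data (`quantile_sq_le`). With
`J ≈ (rc)^{1/4}` the difference of the risks is `O((rc)^{-1/8} ν λ₁(Q))` (`abs_risk_sub_le_rate`).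
-/

namespace TwoWay

open scoped MatrixOrder

/-! ### Positive semidefinite matrices -/

section PosSemidef

theorem transpose_eq_of_nonneg {n : Type*} {A : Matrix n n ℝ} (h : 0 ≤ A) : Aᵀ = A :=
  (Matrix.nonneg_iff_posSemidef.mp h).1

theorem one_nonneg_matrix {n : Type*} [DecidableEq n] : (0 : Matrix n n ℝ) ≤ 1 :=
  Matrix.nonneg_iff_posSemidef.mpr Matrix.PosSemidef.one

variable {n : Type*} [Fintype n]

theorem posSemidef_of_forall {A : Matrix n n ℝ} (hA : Aᵀ = A)
    (h : ∀ x : n → ℝ, 0 ≤ x ⬝ᵥ (A *ᵥ x)) : A.PosSemidef :=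
  Matrix.PosSemidef.of_dotProduct_mulVec_nonneg hA (by simpa using h)

theorem quad_mono {A B : Matrix n n ℝ} (h : A ≤ B) (x : n → ℝ) :
    x ⬝ᵥ (A *ᵥ x) ≤ x ⬝ᵥ (B *ᵥ x) := by
  have := (Matrix.le_iff.mp h).dotProduct_mulVec_nonneg x
  simpa [Matrix.sub_mulVec] using this

theorem quad_nonneg {A : Matrix n n ℝ} (h : 0 ≤ A) (x : n → ℝ) : 0 ≤ x ⬝ᵥ (A *ᵥ x) := by
  simpa using quad_mono h x

theorem congr_nonneg {A : Matrix n n ℝ} (h : 0 ≤ A) (B : Matrix n n ℝ) : 0 ≤ B * A * Bᵀ := by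
  rw [Matrix.nonneg_iff_posSemidef] at *
  simpa using h.mul_mul_conjTranspose_same B

theorem dotProduct_mulVec_comm {A : Matrix n n ℝ} (hA : Aᵀ = A) (x y : n → ℝ) :
    x ⬝ᵥ (A *ᵥ y) = y ⬝ᵥ (A *ᵥ x) := by
  rw [Matrix.dotProduct_mulVec, ← Matrix.mulVec_transpose, hA, dotProduct_comm]

theorem dotProduct_self_nonneg' (x : n → ℝ) : 0 ≤ x ⬝ᵥ x :=
  Finset.sum_nonneg fun i _ => mul_self_nonneg (x i)

/-- The Cauchy-Schwarz inequality for a positive semidefinite form. -/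
theorem dotProduct_mulVec_sq_le {A : Matrix n n ℝ} (hA : 0 ≤ A) (x y : n → ℝ) :
    (x ⬝ᵥ (A *ᵥ y)) ^ 2 ≤ (x ⬝ᵥ (A *ᵥ x)) * (y ⬝ᵥ (A *ᵥ y)) := by
  have key : ∀ t : ℝ, 0 ≤ (y ⬝ᵥ (A *ᵥ y)) * (t * t) + (2 * (x ⬝ᵥ (A *ᵥ y))) * t
      + x ⬝ᵥ (A *ᵥ x) := by
    intro t
    have h := quad_nonneg hA (x + t • y)
    have hc := dotProduct_mulVec_comm (transpose_eq_of_nonneg hA) y x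
    simp only [Matrix.mulVec_add, Matrix.mulVec_smul, dotProduct_add, add_dotProduct,
      smul_dotProduct, dotProduct_smul, smul_eq_mul, hc] at h
    linarith
  have := discrim_le_zero key
  rw [discrim] at this
  nlinarith

/-- `‖G x‖ ≤ κ ‖x‖` for the Euclidean norm: `κ` bounds the operator norm of `G`. -/
def OpBound (G : Matrix n n ℝ) (κ : ℝ) : Prop :=
  ∀ x : n → ℝ, (G *ᵥ x) ⬝ᵥ (G *ᵥ x) ≤ κ ^ 2 * (x ⬝ᵥ x)

theorem OpBound.mul {G H : Matrix n n ℝ} {κ ι : ℝ} (hG : OpBound G κ) (hH : OpBound H ι) :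
    OpBound (G * H) (κ * ι) := by
  intro x
  rw [← Matrix.mulVec_mulVec]
  calc _ ≤ κ ^ 2 * ((H *ᵥ x) ⬝ᵥ (H *ᵥ x)) := hG _
    _ ≤ κ ^ 2 * (ι ^ 2 * (x ⬝ᵥ x)) := by gcongr; exact hH x
    _ = _ := by ring

theorem trace_mono {A B : Matrix n n ℝ} (h : A ≤ B) : A.trace ≤ B.trace := by
  have := (Matrix.le_iff.mp h).trace_nonneg
  rw [Matrix.trace_sub] at this
  linarith

theorem sandwich_nonneg {T Δ : Matrix n n ℝ} (hT : 0 ≤ T) (h0 : 0 ≤ Δ) : 0 ≤ T * Δ * T := by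
  have := congr_nonneg h0 T
  rwa [transpose_eq_of_nonneg hT] at this

theorem posDef_of_le {n : Type*} {A B : Matrix n n ℝ} (hA : A.PosDef) (h : A ≤ B) : B.PosDef := by
  simpa using hA.add_posSemidef (Matrix.le_iff.mp h)

variable [DecidableEq n]

theorem opBound_of_le_smul_one {S : Matrix n n ℝ} {κ : ℝ} (h0 : 0 ≤ S)
    (h1 : S ≤ κ • (1 : Matrix n n ℝ)) : OpBound S κ := by
  intro x
  have hS := transpose_eq_of_nonneg h0
  set z := S *ᵥ x with hz
  have hq : ∀ v : n → ℝ, v ⬝ᵥ (S *ᵥ v) ≤ κ * (v ⬝ᵥ v) := fun v => by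
    have := quad_mono h1 v
    simpa [Matrix.smul_mulVec] using this
  have hcs := dotProduct_mulVec_sq_le h0 z x
  rw [← hz] at hcs
  have h2 : x ⬝ᵥ z ≤ κ * (x ⬝ᵥ x) := hq x
  have h3 : z ⬝ᵥ (S *ᵥ z) ≤ κ * (z ⬝ᵥ z) := hq z
  have h4 : 0 ≤ x ⬝ᵥ z := quad_nonneg h0 x
  have h5 := quad_nonneg h0 z
  have hzz := dotProduct_self_nonneg' z
  have hxx := dotProduct_self_nonneg' x
  rcases hzz.eq_or_lt with h | h
  · rw [← h]; positivity
  · have h6 : (z ⬝ᵥ z) ^ 2 ≤ (z ⬝ᵥ z) * (κ ^ 2 * (x ⬝ᵥ x)) := by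
      calc (z ⬝ᵥ z) ^ 2 ≤ _ := hcs
        _ ≤ (κ * (z ⬝ᵥ z)) * (κ * (x ⬝ᵥ x)) := by gcongr; exact h5.trans h3
        _ = _ := by ring
    rw [sq] at h6
    exact le_of_mul_le_mul_left h6 h

theorem OpBound.sum_sq_le {G : Matrix n n ℝ} {κ : ℝ} (hG : OpBound G κ) :
    ∑ i, ∑ j, G i j ^ 2 ≤ Fintype.card n * κ ^ 2 := by
  rw [Finset.sum_comm]
  calc ∑ j, ∑ i, G i j ^ 2 ≤ ∑ _j : n, κ ^ 2 := by
        refine Finset.sum_le_sum fun j _ => ?_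
        have := hG (Pi.single j 1)
        simpa [dotProduct, sq, Pi.single_apply] using this
    _ = _ := by simp

theorem trace_mul_nonneg {A B : Matrix n n ℝ} (hA : 0 ≤ A) (hB : 0 ≤ B) :
    0 ≤ (A * B).trace := by
  obtain ⟨C, rfl⟩ := CStarAlgebra.nonneg_iff_eq_star_mul_self.mp hB
  rw [← mul_assoc, Matrix.trace_mul_comm, ← mul_assoc]
  have := congr_nonneg hA C
  exact (Matrix.nonneg_iff_posSemidef.mp this).trace_nonneg

theorem trace_mul_mono {A A' B : Matrix n n ℝ} (hA : A ≤ A') (hB : 0 ≤ B) :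
    (A * B).trace ≤ (A' * B).trace := by
  have := trace_mul_nonneg (sub_nonneg.mpr hA) hB
  rw [sub_mul, Matrix.trace_sub] at this
  linarith

theorem le_smul_one {S : Matrix n n ℝ} {κ : ℝ} (hS : Sᵀ = S)
    (h : ∀ x : n → ℝ, x ⬝ᵥ (S *ᵥ x) ≤ κ * (x ⬝ᵥ x)) : S ≤ κ • (1 : Matrix n n ℝ) := by
  refine Matrix.le_iff.mpr (posSemidef_of_forall (by simp [hS]) fun x => ?_)
  have := h x
  simpa [Matrix.sub_mulVec, Matrix.smul_mulVec] using this

/-- The sandwich `T Δ T` of a contraction `Δ` by `0 ≤ T ≤ λ`. -/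
theorem sandwich_le {T Δ : Matrix n n ℝ} {lam : ℝ} (hT : 0 ≤ T)
    (hT1 : T ≤ lam • (1 : Matrix n n ℝ)) (h1 : Δ ≤ 1) (h0 : 0 ≤ Δ) :
    T * Δ * T ≤ lam ^ 2 • (1 : Matrix n n ℝ) := by
  have hTt := transpose_eq_of_nonneg hT
  refine le_smul_one (by simp [Matrix.transpose_mul, hTt, transpose_eq_of_nonneg h0,
    Matrix.mul_assoc]) fun x => ?_
  have h2 := quad_mono h1 (T *ᵥ x)
  have h3 := opBound_of_le_smul_one hT hT1 x
  rw [Matrix.one_mulVec] at h2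
  calc x ⬝ᵥ ((T * Δ * T) *ᵥ x) = (T *ᵥ x) ⬝ᵥ (Δ *ᵥ (T *ᵥ x)) := by
        rw [← Matrix.mulVec_mulVec, ← Matrix.mulVec_mulVec, dotProduct_mulVec_comm hTt,
          dotProduct_comm]
    _ ≤ _ := h2.trans h3

theorem trace_sandwich_le {T Δ : Matrix n n ℝ} {lam : ℝ} (hT : 0 ≤ T)
    (hT1 : T ≤ lam • (1 : Matrix n n ℝ)) (h0 : 0 ≤ Δ) :
    (T * Δ * T).trace ≤ lam ^ 2 * Δ.trace := by
  have h := sandwich_le hT hT1 le_rfl one_nonneg_matrix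
  rw [mul_one] at h
  rw [Matrix.mul_assoc, Matrix.trace_mul_comm, Matrix.mul_assoc, Matrix.trace_mul_comm]
  calc _ ≤ ((lam ^ 2 • (1 : Matrix n n ℝ)) * Δ).trace := trace_mul_mono h h0
    _ = _ := by simp

theorem PosDef.inv_sub_inv {A B : Matrix n n ℝ} (hA : A.PosDef) (hB : B.PosDef) :
    A⁻¹ - B⁻¹ = A⁻¹ * (B - A) * B⁻¹ :=
  Matrix.inv_sub_inv (iff_of_true hA.isUnit hB.isUnit)

/-- With `E = B - A`, the difference `A⁻¹ - B⁻¹` equals `B⁻¹ E B⁻¹ + B⁻¹ E A⁻¹ E B⁻¹`. -/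
theorem inv_antitone {A B : Matrix n n ℝ} (hA : A.PosDef) (h : A ≤ B) : B⁻¹ ≤ A⁻¹ := by
  have hE := Matrix.le_iff.mp h
  have hB := posDef_of_le hA h
  have e1 := PosDef.inv_sub_inv hB hA
  have e3 : A⁻¹ = B⁻¹ + A⁻¹ * (B - A) * B⁻¹ := by rw [← PosDef.inv_sub_inv hA hB]; abel
  have e : A⁻¹ - B⁻¹ = B⁻¹ * (B - A) * B⁻¹ᵀ + (B⁻¹ * (B - A)) * A⁻¹ * (B⁻¹ * (B - A))ᵀ := by
    have t1 : B⁻¹ᵀ = B⁻¹ := hB.inv.1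
    have t2 : (B - A)ᵀ = B - A := hE.1
    rw [Matrix.transpose_mul, t1, t2, ← neg_sub, e1, ← neg_sub B A, mul_neg, neg_mul, neg_neg]
    conv_lhs => rw [e3]
    simp only [mul_add, Matrix.mul_assoc]
  rw [Matrix.le_iff, e, ← Matrix.nonneg_iff_posSemidef]
  exact add_nonneg (congr_nonneg hE.nonneg _) (congr_nonneg hA.inv.posSemidef.nonneg _)

/-- The first-order term of the resolvent expansion dominates: with `E = B - A`, the remainder
`A⁻¹ E A⁻¹ - (A⁻¹ - B⁻¹)` equals `A⁻¹ E B⁻¹ E A⁻¹`. -/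
theorem inv_sub_inv_le {A B : Matrix n n ℝ} (hA : A.PosDef) (h : A ≤ B) :
    A⁻¹ - B⁻¹ ≤ A⁻¹ * (B - A) * A⁻¹ := by
  have hE := Matrix.le_iff.mp h
  have hB := posDef_of_le hA h
  have e2 := PosDef.inv_sub_inv hA hB
  have e1 := PosDef.inv_sub_inv hB hA
  have t1 : A⁻¹ᵀ = A⁻¹ := hA.inv.1
  have t2 : (B - A)ᵀ = B - A := hE.1
  have e : A⁻¹ * (B - A) * A⁻¹ - (A⁻¹ - B⁻¹)
      = (A⁻¹ * (B - A)) * B⁻¹ * (A⁻¹ * (B - A))ᵀ := by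
    have e1' : A⁻¹ - B⁻¹ = B⁻¹ * (B - A) * A⁻¹ := by
      rw [← neg_sub, e1, ← neg_sub B A, mul_neg, neg_mul, neg_neg]
    rw [Matrix.transpose_mul, t1, t2, e2, ← mul_sub, e1']
    simp only [Matrix.mul_assoc]
  rw [Matrix.le_iff, e, ← Matrix.nonneg_iff_posSemidef]
  exact congr_nonneg hB.inv.posSemidef.nonneg _

/-- The eigenvalues of `0 ≤ Δ ≤ 1` are at most `1`, and only `rank Δ` of them are nonzero. -/
theorem trace_le_rank {Δ : Matrix n n ℝ} (h0 : 0 ≤ Δ) (h1 : Δ ≤ 1) : Δ.trace ≤ Δ.rank := by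
  have hH := (Matrix.nonneg_iff_posSemidef.mp h0).1
  rw [hH.trace_eq_sum_eigenvalues, hH.rank_eq_card_non_zero_eigs, Fintype.card_subtype,
    Finset.card_filter]
  push_cast
  refine Finset.sum_le_sum fun i _ => ?_
  have hi : hH.eigenvalues i ≤ 1 := by
    have hq := quad_mono h1 (hH.eigenvectorBasis i)
    have hn : (hH.eigenvectorBasis i : n → ℝ) ⬝ᵥ (hH.eigenvectorBasis i) = 1 := by
      have := hH.eigenvectorBasis.orthonormal.1 i
      have h2 := EuclideanSpace.real_norm_sq_eq (hH.eigenvectorBasis i)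
      rw [this] at h2
      simp only [dotProduct, ← sq]
      linarith
    rw [hH.mulVec_eigenvectorBasis, Matrix.one_mulVec, dotProduct_smul, hn] at hq
    simpa using hq
  by_cases h : hH.eigenvalues i = 0 <;> simp [h, hi]

end PosSemidef

/-! ### Continuity and monotonicity of the precision matrix on `[0, ∞]²` -/

/-- The finite scales, as a subset of `[0, ∞]²`. -/
def finiteScales : Set (ℝ≥0∞ × ℝ≥0∞) := {s | s.1 ≠ ∞ ∧ s.2 ≠ ∞}

theorem zero_mem_finiteScales : (0 : ℝ≥0∞ × ℝ≥0∞) ∈ finiteScales := by simp [finiteScales]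

theorem mem_finiteScales_of_le {s t : ℝ≥0∞ × ℝ≥0∞} (h : s ≤ t) (ht : t ∈ finiteScales) :
    s ∈ finiteScales :=
  ⟨ne_top_of_le_ne_top ht.1 h.1, ne_top_of_le_ne_top ht.2 h.2⟩

/-- A bounded antitone function of the finite scales that is Lipschitz in the scales has a limit
at every point of `[0, ∞]²`, namely its infimum over the finite scales below that point. -/
theorem exists_tendsto_of_antitone_of_lipschitz {f : ℝ≥0∞ × ℝ≥0∞ → ℝ} {L : ℝ}
    (h0 : ∀ s ∈ finiteScales, 0 ≤ f s)
    (hanti : ∀ s ∈ finiteScales, ∀ t ∈ finiteScales, s ≤ t → f t ≤ f s)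
    (hlip : ∀ s ∈ finiteScales, ∀ t ∈ finiteScales, s ≤ t →
      f s - f t ≤ L * ((t.1 - s.1).toReal + (t.2 - s.2).toReal)) (s : ℝ≥0∞ × ℝ≥0∞) :
    ∃ y, Tendsto f (𝓝[finiteScales] s) (𝓝 y) := by
  set S : Set ℝ := f '' {t | t ∈ finiteScales ∧ t ≤ s} with hS
  have hne : S.Nonempty := ⟨f 0, 0, ⟨zero_mem_finiteScales, zero_le⟩, rfl⟩
  have hbd : BddBelow S := ⟨0, by rintro _ ⟨t, ht, rfl⟩; exact h0 t ht.1⟩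
  have hinf : ∀ t u, t ∈ finiteScales → t ⊓ u ∈ finiteScales := fun t u ht =>
    mem_finiteScales_of_le inf_le_left ht
  refine ⟨sInf S, tendsto_order.2 ⟨fun a ha => ?_, fun a ha => ?_⟩⟩
  · -- From below: compare `t` with `t ⊓ s`, which lies below `s`.
    have hlim : Tendsto (fun t : ℝ≥0∞ × ℝ≥0∞ =>
        sInf S - L * ((t.1 - s.1).toReal + (t.2 - s.2).toReal)) (𝓝 s) (𝓝 (sInf S)) := by
      have h1 : Tendsto (fun t : ℝ≥0∞ × ℝ≥0∞ => (t.1 - s.1).toReal) (𝓝 s) (𝓝 0) := by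
        have h := ((ENNReal.continuous_sub_right s.1).comp continuous_fst).tendsto s
        simp only [Function.comp_apply, tsub_self] at h
        simpa [Function.comp_def] using (ENNReal.tendsto_toReal ENNReal.zero_ne_top).comp h
      have h2 : Tendsto (fun t : ℝ≥0∞ × ℝ≥0∞ => (t.2 - s.2).toReal) (𝓝 s) (𝓝 0) := by
        have h := ((ENNReal.continuous_sub_right s.2).comp continuous_snd).tendsto s
        simp only [Function.comp_apply, tsub_self] at h
        simpa [Function.comp_def] using (ENNReal.tendsto_toReal ENNReal.zero_ne_top).comp h
      simpa using tendsto_const_nhds.sub ((h1.add h2).const_mul L)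
    filter_upwards [nhdsWithin_le_nhds (hlim.eventually (lt_mem_nhds ha)), self_mem_nhdsWithin]
      with t ht htF
    have h1 : sInf S ≤ f (t ⊓ s) :=
      csInf_le hbd ⟨t ⊓ s, ⟨hinf t s htF, inf_le_right⟩, rfl⟩
    have h2 := hlip _ (hinf t s htF) t htF inf_le_left
    have e1 : t.1 - (t ⊓ s).1 = t.1 - s.1 := tsub_min
    have e2 : t.2 - (t ⊓ s).2 = t.2 - s.2 := tsub_min
    rw [e1, e2] at h2
    linarith
  · -- From above: compare `t` with an almost optimal `u ≤ s`.
    obtain ⟨_, ⟨u, ⟨huF, hus⟩, rfl⟩, hu⟩ := exists_lt_of_csInf_lt hne ha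
    have hlim : Tendsto (fun t : ℝ≥0∞ × ℝ≥0∞ =>
        f u + L * ((u.1 - t.1).toReal + (u.2 - t.2).toReal)) (𝓝 s) (𝓝 (f u)) := by
      have h1 : Tendsto (fun t : ℝ≥0∞ × ℝ≥0∞ => (u.1 - t.1).toReal) (𝓝 s) (𝓝 0) := by
        have h := ((ENNReal.continuous_sub_left huF.1).comp continuous_fst).tendsto s
        simp only [Function.comp_apply, tsub_eq_zero_of_le hus.1] at h
        simpa [Function.comp_def] using (ENNReal.tendsto_toReal ENNReal.zero_ne_top).comp h
      have h2 : Tendsto (fun t : ℝ≥0∞ × ℝ≥0∞ => (u.2 - t.2).toReal) (𝓝 s) (𝓝 0) := by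
        have h := ((ENNReal.continuous_sub_left huF.2).comp continuous_snd).tendsto s
        simp only [Function.comp_apply, tsub_eq_zero_of_le hus.2] at h
        simpa [Function.comp_def] using (ENNReal.tendsto_toReal ENNReal.zero_ne_top).comp h
      simpa using tendsto_const_nhds.add ((h1.add h2).const_mul L)
    filter_upwards [nhdsWithin_le_nhds (hlim.eventually (gt_mem_nhds hu)), self_mem_nhdsWithin]
      with t ht htF
    have h1 := hanti _ (hinf u t huF) t htF inf_le_right
    have h2 := hlip _ (hinf u t huF) u huF inf_le_left
    have e1 : u.1 - (u ⊓ t).1 = u.1 - t.1 := tsub_min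
    have e2 : u.2 - (u ⊓ t).2 = u.2 - t.2 := tsub_min
    rw [e1, e2] at h2
    linarith

/-- A symmetric matrix-valued function has a limit as soon as its quadratic forms do. -/
theorem exists_tendsto_of_quad {X n : Type*} [Fintype n] [DecidableEq n] {l : Filter X}
    {G : X → Matrix n n ℝ} (hG : ∀ s, (G s)ᵀ = G s)
    (h : ∀ x : n → ℝ, ∃ y, Tendsto (fun s => x ⬝ᵥ (G s *ᵥ x)) l (𝓝 y)) :
    ∃ Y, Tendsto G l (𝓝 Y) := by
  choose q hq using h
  refine ⟨Matrix.of fun i j => (q (Pi.single i 1 + Pi.single j 1)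
    - q (Pi.single i 1 - Pi.single j 1)) / 4, ?_⟩
  refine tendsto_pi_nhds.2 fun i => tendsto_pi_nhds.2 fun j => ?_
  have h1 := ((hq (Pi.single i 1 + Pi.single j 1)).sub
    (hq (Pi.single i 1 - Pi.single j 1))).div_const 4
  refine h1.congr fun s => ?_
  have hs : G s j i = G s i j := congrFun (congrFun (hG s) i) j
  simp only [Matrix.mulVec_add, Matrix.mulVec_sub, dotProduct_add, add_dotProduct,
    sub_dotProduct, dotProduct_sub, Matrix.mulVec_single_one, single_one_dotProduct,
    Matrix.col_apply, hs]
  ring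

theorem le_trace_smul_one {n : Type*} [Fintype n] [DecidableEq n] {A : Matrix n n ℝ}
    (hA : 0 ≤ A) : A ≤ A.trace • (1 : Matrix n n ℝ) := by
  refine le_smul_one (transpose_eq_of_nonneg hA) fun x => ?_
  obtain ⟨C, rfl⟩ := CStarAlgebra.nonneg_iff_eq_star_mul_self.mp hA
  have e1 : x ⬝ᵥ ((star C * C) *ᵥ x) = ∑ i, (C *ᵥ x) i ^ 2 := by
    rw [← Matrix.mulVec_mulVec, Matrix.dotProduct_mulVec, Matrix.star_eq_conjTranspose,
      Matrix.conjTranspose_eq_transpose_of_trivial, Matrix.vecMul_transpose]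
    simp [dotProduct, sq]
  have e2 : (star C * C).trace = ∑ i, ∑ j, C i j ^ 2 := by
    rw [Finset.sum_comm]
    simp [Matrix.trace, Matrix.mul_apply, sq]
  rw [e1, e2, Finset.sum_mul]
  refine Finset.sum_le_sum fun i _ => ?_
  have := Finset.sum_mul_sq_le_sq_mul_sq Finset.univ (C i) x
  simpa [dotProduct, Matrix.mulVec, sq] using this

section Design

variable {r c : ℕ} (K : Fin r × Fin c → ℕ)

/-- The columns of the design matrix that belong to the rows of the layout. -/
def designA : Matrix (Obs K) (Fin r) ℝ := (design K).submatrix id Sum.inl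

/-- The columns of the design matrix that belong to the columns of the layout. -/
def designB : Matrix (Obs K) (Fin c) ℝ := (design K).submatrix id Sum.inr

theorem margCov_eq {a b : ℝ} (ha : 0 ≤ a) (hb : 0 ≤ b) :
    margCov K a b = a • (designA K * (designA K)ᵀ) + b • (designB K * (designB K)ᵀ)
      + errCov K := by
  unfold margCov
  congr 1
  have : scaleMat r c a b * (scaleMat r c a b)ᵀ
      = Matrix.diagonal (Sum.elim (fun _ => a) (fun _ => b)) := by
    rw [scaleMat, Matrix.diagonal_transpose, Matrix.diagonal_mul_diagonal]
    congr 1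
    funext i
    cases i <;> simp [Real.mul_self_sqrt, ha, hb]
  rw [Matrix.mul_assoc (design K), this]
  ext p q
  simp [Matrix.mul_apply, Matrix.diagonal_apply, designA, designB, Fintype.sum_sum_type,
    Finset.mul_sum]
  congr 1 <;> refine Finset.sum_congr rfl fun i _ => ?_ <;> ring

theorem errCov_posDef : (errCov K).PosDef := Matrix.PosDef.diagonal fun p => by
  have := p.2
  positivity

theorem nonneg_mul_transpose {m n : Type*} [Fintype m] [Fintype n] (A : Matrix m n ℝ) :
    0 ≤ A * Aᵀ := by
  rw [Matrix.nonneg_iff_posSemidef]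
  simpa using Matrix.posSemidef_self_mul_conjTranspose A

theorem smul_nonneg_matrix {n : Type*} [Fintype n] {A : Matrix n n ℝ} (hA : 0 ≤ A) {t : ℝ}
    (ht : 0 ≤ t) : 0 ≤ t • A := by
  rw [Matrix.nonneg_iff_posSemidef] at *
  exact hA.smul ht

theorem margCov_posDef {a b : ℝ} (ha : 0 ≤ a) (hb : 0 ≤ b) : (margCov K a b).PosDef := by
  rw [margCov_eq K ha hb]
  refine (errCov_posDef K).posSemidef_add (Matrix.nonneg_iff_posSemidef.mp ?_)
  exact add_nonneg (smul_nonneg_matrix (nonneg_mul_transpose _) ha)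
    (smul_nonneg_matrix (nonneg_mul_transpose _) hb)

theorem margCov_sub {a b a' b' : ℝ} (ha : 0 ≤ a) (hb : 0 ≤ b) (ha' : 0 ≤ a') (hb' : 0 ≤ b') :
    margCov K a' b' - margCov K a b = (a' - a) • (designA K * (designA K)ᵀ)
      + (b' - b) • (designB K * (designB K)ᵀ) := by
  rw [margCov_eq K ha hb, margCov_eq K ha' hb', sub_smul, sub_smul]
  abel

theorem margCov_mono {a b a' b' : ℝ} (ha : 0 ≤ a) (hb : 0 ≤ b) (haa : a ≤ a') (hbb : b ≤ b') :
    margCov K a b ≤ margCov K a' b' := by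
  rw [← sub_nonneg, margCov_sub K ha hb (ha.trans haa) (hb.trans hbb)]
  exact add_nonneg (smul_nonneg_matrix (nonneg_mul_transpose _) (sub_nonneg.2 haa))
    (smul_nonneg_matrix (nonneg_mul_transpose _) (sub_nonneg.2 hbb))

theorem margCov_zero : margCov K 0 0 = errCov K := by
  simp [margCov_eq K le_rfl le_rfl]

theorem margCov_inv_le {a b : ℝ} (ha : 0 ≤ a) (hb : 0 ≤ b) :
    (margCov K a b)⁻¹ ≤ (errCov K)⁻¹ := by
  refine inv_antitone (errCov_posDef K) ?_
  rw [← margCov_zero]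
  exact margCov_mono K le_rfl le_rfl ha hb

/-- `Σ⁻¹` converges at every point of `[0, ∞]²`: the quadratic forms of `Σ⁻¹` are bounded,
decrease in the scales, and are Lipschitz in them because `Σ ≥ M`. -/
theorem exists_tendsto_margCov_inv (s : ℝ≥0∞ × ℝ≥0∞) :
    ∃ Y, Tendsto (fun s : ℝ≥0∞ × ℝ≥0∞ => (margCov K s.1.toReal s.2.toReal)⁻¹)
      (𝓝[finiteScales] s) (𝓝 Y) := by
  have hpd : ∀ s : ℝ≥0∞ × ℝ≥0∞, (margCov K s.1.toReal s.2.toReal).PosDef := fun s =>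
    margCov_posDef K ENNReal.toReal_nonneg ENNReal.toReal_nonneg
  refine exists_tendsto_of_quad (fun s => (hpd s).inv.1) fun x => ?_
  set κ := (errCov K)⁻¹.trace
  set A := designA K * (designA K)ᵀ with hA
  set B := designB K * (designB K)ᵀ with hB
  have hA0 : 0 ≤ A := nonneg_mul_transpose _
  have hB0 : 0 ≤ B := nonneg_mul_transpose _
  have hAt : 0 ≤ A.trace := (Matrix.nonneg_iff_posSemidef.mp hA0).trace_nonneg
  have hBt : 0 ≤ B.trace := (Matrix.nonneg_iff_posSemidef.mp hB0).trace_nonneg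
  have hxx := dotProduct_self_nonneg' x
  have hmono : ∀ s ∈ finiteScales, ∀ t ∈ finiteScales, s ≤ t →
      margCov K s.1.toReal s.2.toReal ≤ margCov K t.1.toReal t.2.toReal := fun s _ t ht hst =>
    margCov_mono K ENNReal.toReal_nonneg ENNReal.toReal_nonneg
      (ENNReal.toReal_mono ht.1 hst.1) (ENNReal.toReal_mono ht.2 hst.2)
  refine exists_tendsto_of_antitone_of_lipschitz (L := (A.trace + B.trace) * (κ ^ 2 * (x ⬝ᵥ x)))
    (fun s _ => quad_nonneg (hpd s).inv.posSemidef.nonneg x)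
    (fun s hs t ht hst => quad_mono (inv_antitone (hpd s) (hmono s hs t ht hst)) x)
    (fun s hs t ht hst => ?_) s
  have h1 := quad_mono (inv_sub_inv_le (hpd s) (hmono s hs t ht hst)) x
  rw [Matrix.sub_mulVec, dotProduct_sub] at h1
  refine h1.trans ?_
  rw [margCov_sub K ENNReal.toReal_nonneg ENNReal.toReal_nonneg ENNReal.toReal_nonneg
    ENNReal.toReal_nonneg, ← ENNReal.toReal_sub_of_le hst.1 ht.1,
    ← ENNReal.toReal_sub_of_le hst.2 ht.2]
  set P := (margCov K s.1.toReal s.2.toReal)⁻¹ with hP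
  have hPt : Pᵀ = P := (hpd s).inv.1
  have hP0 : 0 ≤ P := (hpd s).inv.posSemidef.nonneg
  have hPle : P ≤ κ • (1 : Matrix (Obs K) (Obs K) ℝ) :=
    (margCov_inv_le K ENNReal.toReal_nonneg ENNReal.toReal_nonneg).trans
      (le_trace_smul_one (errCov_posDef K).inv.posSemidef.nonneg)
  set z := P *ᵥ x with hz
  have hzz : z ⬝ᵥ z ≤ κ ^ 2 * (x ⬝ᵥ x) := opBound_of_le_smul_one hP0 hPle x
  have hzA : z ⬝ᵥ (A *ᵥ z) ≤ A.trace * (κ ^ 2 * (x ⬝ᵥ x)) := by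
    have := quad_mono (le_trace_smul_one hA0) z
    rw [Matrix.smul_mulVec, Matrix.one_mulVec, dotProduct_smul, smul_eq_mul] at this
    exact this.trans (by gcongr)
  have hzB : z ⬝ᵥ (B *ᵥ z) ≤ B.trace * (κ ^ 2 * (x ⬝ᵥ x)) := by
    have := quad_mono (le_trace_smul_one hB0) z
    rw [Matrix.smul_mulVec, Matrix.one_mulVec, dotProduct_smul, smul_eq_mul] at this
    exact this.trans (by gcongr)
  have hda : 0 ≤ (t.1 - s.1).toReal := ENNReal.toReal_nonneg
  have hdb : 0 ≤ (t.2 - s.2).toReal := ENNReal.toReal_nonneg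
  have e : ∀ E : Matrix (Obs K) (Obs K) ℝ, x ⬝ᵥ ((P * E * P) *ᵥ x) = z ⬝ᵥ (E *ᵥ z) := by
    intro E
    rw [← Matrix.mulVec_mulVec, ← Matrix.mulVec_mulVec, dotProduct_mulVec_comm hPt,
      dotProduct_comm]
  rw [e, Matrix.add_mulVec, Matrix.smul_mulVec, Matrix.smul_mulVec, dotProduct_add,
    dotProduct_smul, dotProduct_smul, smul_eq_mul, smul_eq_mul]
  have g1 := mul_le_mul_of_nonneg_left hzA hda
  have g2 := mul_le_mul_of_nonneg_left hzB hdb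
  have g3 : 0 ≤ A.trace * (κ ^ 2 * (x ⬝ᵥ x)) * (t.2 - s.2).toReal := by positivity
  have g4 : 0 ≤ B.trace * (κ ^ 2 * (x ⬝ᵥ x)) * (t.1 - s.1).toReal := by positivity
  nlinarith

/-- The truncation `s ⊓ (k, k)` of a pair of scales. -/
noncomputable def truncScale (k : ℕ) (s : ℝ≥0∞ × ℝ≥0∞) : ℝ≥0∞ × ℝ≥0∞ := (s.1 ⊓ k, s.2 ⊓ k)

theorem truncScale_mem (k : ℕ) (s : ℝ≥0∞ × ℝ≥0∞) : truncScale k s ∈ finiteScales :=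
  ⟨ne_top_of_le_ne_top (ENNReal.natCast_ne_top k) inf_le_right,
    ne_top_of_le_ne_top (ENNReal.natCast_ne_top k) inf_le_right⟩

theorem truncScale_mono (k : ℕ) {s t : ℝ≥0∞ × ℝ≥0∞} (h : s ≤ t) :
    truncScale k s ≤ truncScale k t :=
  ⟨inf_le_inf_right _ h.1, inf_le_inf_right _ h.2⟩

theorem tendsto_truncScale (s : ℝ≥0∞ × ℝ≥0∞) :
    Tendsto (fun k => truncScale k s) atTop (𝓝 s) := by
  have h : ∀ a : ℝ≥0∞, Tendsto (fun k : ℕ => a ⊓ (k : ℝ≥0∞)) atTop (𝓝 a) := fun a => by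
    simpa using (tendsto_const_nhds (x := a)).min ENNReal.tendsto_nat_nhds_top
  exact (h s.1).prodMk_nhds (h s.2)

theorem dense_finiteScales : Dense finiteScales := fun s =>
  mem_closure_of_tendsto (tendsto_truncScale s) (Eventually.of_forall fun k => truncScale_mem k s)

theorem continuous_margPrec : Continuous (margPrec K) :=
  continuous_extendFrom dense_finiteScales (exists_tendsto_margCov_inv K)

end Design

theorem isClosed_nonneg_matrix {n : Type*} [Fintype n] [DecidableEq n] :
    IsClosed {A : Matrix n n ℝ | 0 ≤ A} := by
  have : {A : Matrix n n ℝ | 0 ≤ A}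
      = {A | Aᵀ = A} ∩ ⋂ x : n → ℝ, {A | 0 ≤ x ⬝ᵥ (A *ᵥ x)} := by
    ext A
    simp only [Set.mem_ofPred_eq, Set.mem_inter_iff, Set.mem_iInter]
    exact ⟨fun h => ⟨transpose_eq_of_nonneg h, quad_nonneg h⟩,
      fun h => (posSemidef_of_forall h.1 h.2).nonneg⟩
  rw [this]
  refine (isClosed_eq (by fun_prop) (by fun_prop)).inter (isClosed_iInter fun x => ?_)
  exact isClosed_le (by fun_prop) (by fun_prop)

theorem le_of_tendsto_matrix {n : Type*} [Fintype n] [DecidableEq n] {F G : ℕ → Matrix n n ℝ}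
    {A B : Matrix n n ℝ} (hF : Tendsto F atTop (𝓝 A)) (hG : Tendsto G atTop (𝓝 B))
    (h : ∀ k, F k ≤ G k) : A ≤ B := by
  rw [← sub_nonneg]
  exact isClosed_nonneg_matrix.mem_of_tendsto (hG.sub hF)
    (Eventually.of_forall fun k => sub_nonneg.2 (h k))

/-! ### The whitened precision matrix and its brackets -/

section Whitened

variable {r c : ℕ} (K : Fin r × Fin c → ℕ)

/-- `M^{1/2} = diag(K_{ij}^{-1/2})`. -/
noncomputable def errSqrt : Matrix (Obs K) (Obs K) ℝ :=
  Matrix.diagonal fun p => (√(K p : ℝ))⁻¹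

theorem errSqrt_mul_self : errSqrt K * errSqrt K = errCov K := by
  rw [errSqrt, errCov, Matrix.diagonal_mul_diagonal]
  congr 1
  funext p
  rw [← mul_inv, Real.mul_self_sqrt (by positivity)]

theorem errSqrt_transpose : (errSqrt K)ᵀ = errSqrt K := Matrix.diagonal_transpose _

/-- The whitened precision matrix `M^{1/2} Σ⁻¹ M^{1/2}`. -/
noncomputable def whitePrec (s : ℝ≥0∞ × ℝ≥0∞) : Matrix (Obs K) (Obs K) ℝ :=
  errSqrt K * margPrec K s * errSqrt K

theorem continuous_whitePrec : Continuous (whitePrec K) := by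
  have := continuous_margPrec K
  unfold whitePrec
  fun_prop

theorem tendsto_whitePrec_trunc (s : ℝ≥0∞ × ℝ≥0∞) :
    Tendsto (fun k => whitePrec K (truncScale k s)) atTop (𝓝 (whitePrec K s)) :=
  ((continuous_whitePrec K).tendsto s).comp (tendsto_truncScale s)

theorem whitePrec_antitone : Antitone (whitePrec K) := by
  intro s t hst
  refine le_of_tendsto_matrix (tendsto_whitePrec_trunc K t) (tendsto_whitePrec_trunc K s)
    fun k => ?_
  have hs := truncScale_mem k s
  have ht := truncScale_mem k t
  have hst := truncScale_mono k hst
  rw [← sub_nonneg, whitePrec, whitePrec, ← sub_mul, ← mul_sub, margPrec_of_finite K _ hs,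
    margPrec_of_finite K _ ht]
  have h := congr_nonneg (sub_nonneg.2 (inv_antitone
    (margCov_posDef K ENNReal.toReal_nonneg ENNReal.toReal_nonneg)
    (margCov_mono K ENNReal.toReal_nonneg ENNReal.toReal_nonneg
      (ENNReal.toReal_mono ht.1 hst.1) (ENNReal.toReal_mono ht.2 hst.2)))) (errSqrt K)
  rwa [errSqrt_transpose] at h

theorem whitePrec_zero : whitePrec K 0 = 1 := by
  have hu : IsUnit (errSqrt K).det := by
    rw [errSqrt, Matrix.det_diagonal, isUnit_iff_ne_zero, Finset.prod_ne_zero_iff]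
    intro p _
    have := p.2
    positivity
  rw [whitePrec, margPrec_of_finite K _ zero_mem_finiteScales]
  simp only [Prod.fst_zero, Prod.snd_zero, ENNReal.toReal_zero, margCov_zero]
  rw [← errSqrt_mul_self, Matrix.mul_inv_rev, ← Matrix.mul_assoc, Matrix.mul_nonsing_inv _ hu,
    Matrix.one_mul, Matrix.nonsing_inv_mul _ hu]

theorem whitePrec_le_one (s : ℝ≥0∞ × ℝ≥0∞) : whitePrec K s ≤ 1 := by
  rw [← whitePrec_zero K]
  exact whitePrec_antitone K zero_le

theorem whitePrec_nonneg (s : ℝ≥0∞ × ℝ≥0∞) : 0 ≤ whitePrec K s := by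
  refine le_of_tendsto_matrix tendsto_const_nhds (tendsto_whitePrec_trunc K s) fun k => ?_
  rw [whitePrec, margPrec_of_finite K _ (truncScale_mem k s)]
  have h := congr_nonneg (margCov_posDef K (ENNReal.toReal_nonneg (a := (truncScale k s).1))
    (ENNReal.toReal_nonneg (a := (truncScale k s).2))).inv.posSemidef.nonneg (errSqrt K)
  rwa [errSqrt_transpose] at h

/-- A change of scales that adds a multiple of `V Vᵀ` to `Σ` changes the whitened precision by a
contraction of rank at most the number `m` of columns of `V`. The bound passes to infinite scales
by continuity. -/
theorem trace_whitePrec_sub_le_of_factor {m : ℕ} (V : Matrix (Obs K) (Fin m) ℝ)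
    {s t : ℝ≥0∞ × ℝ≥0∞} (hst : s ≤ t)
    (h : ∀ k, ∃ x : ℝ, margCov K (truncScale k t).1.toReal (truncScale k t).2.toReal
      - margCov K (truncScale k s).1.toReal (truncScale k s).2.toReal = x • (V * Vᵀ)) :
    (whitePrec K s).trace - (whitePrec K t).trace ≤ m := by
  have hlim : Tendsto (fun k => (whitePrec K (truncScale k s)).trace
      - (whitePrec K (truncScale k t)).trace) atTop
      (𝓝 ((whitePrec K s).trace - (whitePrec K t).trace)) :=
    ((continuous_id.matrix_trace.tendsto _).comp (tendsto_whitePrec_trunc K s)).sub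
      ((continuous_id.matrix_trace.tendsto _).comp (tendsto_whitePrec_trunc K t))
  refine le_of_tendsto hlim (Eventually.of_forall fun k => ?_)
  have h0 : 0 ≤ whitePrec K (truncScale k s) - whitePrec K (truncScale k t) :=
    sub_nonneg.2 (whitePrec_antitone K (truncScale_mono k hst))
  have h1 : whitePrec K (truncScale k s) - whitePrec K (truncScale k t) ≤ 1 :=
    (sub_le_self _ (whitePrec_nonneg K _)).trans (whitePrec_le_one K _)
  rw [← Matrix.trace_sub]
  refine (trace_le_rank h0 h1).trans ?_
  obtain ⟨x, hx⟩ := h k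
  have e : whitePrec K (truncScale k s) - whitePrec K (truncScale k t)
      = (errSqrt K * margPrec K (truncScale k s) * (x • V))
        * (Vᵀ * (margPrec K (truncScale k t) * errSqrt K)) := by
    rw [whitePrec, whitePrec, ← sub_mul, ← mul_sub, margPrec_of_finite K _ (truncScale_mem k s),
      margPrec_of_finite K _ (truncScale_mem k t), PosDef.inv_sub_inv
      (margCov_posDef K ENNReal.toReal_nonneg ENNReal.toReal_nonneg)
      (margCov_posDef K ENNReal.toReal_nonneg ENNReal.toReal_nonneg), hx]
    simp only [Matrix.mul_assoc, Matrix.smul_mul, Matrix.mul_smul]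
  rw [e]
  have := (Matrix.rank_mul_le_left (errSqrt K * margPrec K (truncScale k s) * (x • V))
    (Vᵀ * (margPrec K (truncScale k t) * errSqrt K))).trans (Matrix.rank_le_card_width _)
  rw [Fintype.card_fin] at this
  exact_mod_cast this

/-- Moving the column scale from `0` to `∞` changes the whitened precision by a matrix of rank at
most the number of columns. -/
theorem trace_whitePrec_sub_le_right (a : ℝ≥0∞) :
    (whitePrec K (a, 0)).trace - (whitePrec K (a, ∞)).trace ≤ c := by
  refine trace_whitePrec_sub_le_of_factor K (designB K) ⟨le_rfl, zero_le⟩ fun k => ?_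
  refine ⟨(truncScale k (a, ∞)).2.toReal - (truncScale k (a, 0)).2.toReal,
    (margCov_sub K ENNReal.toReal_nonneg ENNReal.toReal_nonneg ENNReal.toReal_nonneg
      ENNReal.toReal_nonneg).trans ?_⟩
  simp [truncScale]

theorem trace_whitePrec_sub_le_left (b : ℝ≥0∞) :
    (whitePrec K (0, b)).trace - (whitePrec K (∞, b)).trace ≤ r := by
  refine trace_whitePrec_sub_le_of_factor K (designA K) ⟨zero_le, le_rfl⟩ fun k => ?_
  refine ⟨(truncScale k (∞, b)).1.toReal - (truncScale k (0, b)).1.toReal,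
    (margCov_sub K ENNReal.toReal_nonneg ENNReal.toReal_nonneg ENNReal.toReal_nonneg
      ENNReal.toReal_nonneg).trans ?_⟩
  simp [truncScale]

end Whitened

/-- Finitely many brackets `[lo i, hi i]` of positive semidefinite contractions that cover every
member of the family `W` in the Loewner order. The width of a bracket is measured by the trace of
`hi i - lo i`, which is at most `t`. -/
structure IsBracketing {X n : Type*} [Fintype n] [DecidableEq n] {J : ℕ}
    (W : X → Matrix n n ℝ) (lo hi : Fin J → Matrix n n ℝ) (t : ℝ) : Prop where
  lo_nonneg : ∀ i, 0 ≤ lo i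
  lo_le_hi : ∀ i, lo i ≤ hi i
  hi_le_one : ∀ i, hi i ≤ 1
  trace_le : ∀ i, (hi i - lo i).trace ≤ t
  cover : ∀ s, ∃ i, lo i ≤ W s ∧ W s ≤ hi i

/-- A sequence from `0` to `∞` passes over every point of `[0, ∞]` in an upward step. -/
theorem exists_step {J : ℕ} {a : ℕ → ℝ≥0∞} (h0 : a 0 = 0) (hJ : a J = ∞) (hJ0 : 0 < J)
    (x : ℝ≥0∞) : ∃ i < J, a i ≤ x ∧ x ≤ a (i + 1) := by
  by_contra! hcon
  have h : ∀ i, i < J → a i ≤ x := by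
    intro i
    induction i with
    | zero => intro _; simp [h0]
    | succ i ih => intro hi; exact (hcon i (by omega) (ih (by omega))).le
  have := hcon (J - 1) (by omega) (h (J - 1) (by omega))
  rw [Nat.sub_add_cancel hJ0, hJ] at this
  exact not_top_lt this

/-- An antitone continuous family of contractions on `[0, ∞]²` whose trace drops by at most `k`
along the second variable. The first variable is cut by the intermediate value theorem into `J`
intervals along which the trace drops equally; within a bracket the second variable is free. -/
theorem exists_isBracketing {n : Type*} [Fintype n] [DecidableEq n]
    {W : ℝ≥0∞ × ℝ≥0∞ → Matrix n n ℝ} (hcont : Continuous W) (hanti : Antitone W)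
    (h0 : ∀ s, 0 ≤ W s) (h1 : ∀ s, W s ≤ 1) {k : ℝ}
    (hk : ∀ a, (W (a, 0)).trace - (W (a, ∞)).trace ≤ k) {J : ℕ} (hJ : 0 < J) :
    ∃ lo hi : Fin J → Matrix n n ℝ, IsBracketing W lo hi (Fintype.card n / J + k) := by
  set f : ℝ≥0∞ → ℝ := fun a => (W (a, 0)).trace with hf
  have hfc : Continuous f := (hcont.comp (by fun_prop : Continuous fun a : ℝ≥0∞ =>
    (a, (0 : ℝ≥0∞)))).matrix_trace
  have hfa : Antitone f := fun a b hab => trace_mono (hanti ⟨hab, le_rfl⟩)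
  have hftop : 0 ≤ f ∞ := (Matrix.nonneg_iff_posSemidef.mp (h0 _)).trace_nonneg
  have hf0 : f 0 ≤ Fintype.card n := by
    simpa using trace_mono (h1 (0, 0))
  have hd : 0 ≤ f 0 - f ∞ := sub_nonneg.2 (hfa zero_le)
  have hJ' : (0 : ℝ) < J := by exact_mod_cast hJ
  have hlev : ∀ i : ℕ, ∃ a : ℝ≥0∞, (i ≤ J → f a = f 0 - i / J * (f 0 - f ∞)) ∧
      (i = 0 → a = 0) ∧ (i = J → a = ∞) := by
    intro i
    rcases Nat.eq_zero_or_pos i with rfl | hi0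
    · exact ⟨0, by simp, by simp, fun h => absurd h hJ.ne⟩
    rcases eq_or_ne i J with rfl | hiJ
    · refine ⟨∞, fun _ => ?_, fun h => absurd h hJ.ne', fun _ => rfl⟩
      rw [div_self hJ'.ne']; ring
    by_cases hle : i ≤ J
    · have hq0 : 0 ≤ (i : ℝ) / J := by positivity
      have hq1 : (i : ℝ) / J ≤ 1 := by rw [div_le_one hJ']; exact_mod_cast hle
      obtain ⟨a, _, ha⟩ := intermediate_value_Icc' (zero_le (a := (∞ : ℝ≥0∞))) hfc.continuousOn
        (show f 0 - i / J * (f 0 - f ∞) ∈ Set.Icc (f ∞) (f 0) from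
          ⟨by nlinarith, by nlinarith⟩)
      exact ⟨a, fun _ => ha, fun h => absurd h hi0.ne', fun h => absurd h hiJ⟩
    · exact ⟨0, fun h => absurd h hle, fun _ => rfl, fun h => absurd h hiJ⟩
  choose a ha ha0 haJ using hlev
  -- The cut points need not increase with `i`; the maximum keeps every bracket well ordered.
  refine ⟨fun i => W (max (a i) (a (i + 1)), ∞), fun i => W (a i, 0), fun i => h0 _,
    fun i => hanti ⟨le_max_left _ _, zero_le⟩, fun i => h1 _, fun i => ?_, fun s => ?_⟩
  · rw [Matrix.trace_sub]
    have e1 := hk (max (a i) (a (i + 1)))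
    have e2 : f (a i) - f (max (a i) (a (i + 1))) ≤ Fintype.card n / J := by
      rcases le_total (a i) (a (i + 1)) with h | h
      · rw [max_eq_right h, ha i i.2.le, ha (i + 1) i.2]
        have : f 0 - (i : ℕ) / J * (f 0 - f ∞) - (f 0 - ((i : ℕ) + 1 : ℕ) / J * (f 0 - f ∞))
            = (f 0 - f ∞) / J := by
          push_cast; field_simp; ring
        rw [this]
        gcongr
        linarith
      · rw [max_eq_left h, sub_self]; positivity
    simp only [hf] at e2
    linarith
  · obtain ⟨i, hi, h2, h3⟩ := exists_step (ha0 0 rfl) (haJ J rfl) hJ s.1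
    exact ⟨⟨i, hi⟩, hanti ⟨h3.trans (le_max_right _ _), le_top⟩, hanti ⟨h2, zero_le⟩⟩

/-- The brackets of the whitened precision matrix: the scale whose design block has the smaller
rank is left free. -/
theorem exists_isBracketing_whitePrec {r c : ℕ} (K : Fin r × Fin c → ℕ) {J : ℕ} (hJ : 0 < J) :
    ∃ lo hi : Fin J → Matrix (Obs K) (Obs K) ℝ,
      IsBracketing (whitePrec K) lo hi (Fintype.card (Obs K) / J + min (r : ℝ) c) := by
  rcases le_total (c : ℝ) r with h | h
  · rw [min_eq_right h]
    exact exists_isBracketing (continuous_whitePrec K) (whitePrec_antitone K) (whitePrec_nonneg K)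
      (whitePrec_le_one K) (trace_whitePrec_sub_le_right K) hJ
  · rw [min_eq_left h]
    obtain ⟨lo, hi, hb⟩ := exists_isBracketing (W := fun s => whitePrec K s.swap)
      ((continuous_whitePrec K).comp continuous_swap)
      (fun s t hst => whitePrec_antitone K ⟨hst.2, hst.1⟩) (fun s => whitePrec_nonneg K _)
      (fun s => whitePrec_le_one K _) (trace_whitePrec_sub_le_left K) hJ
    exact ⟨lo, hi, hb.lo_nonneg, hb.lo_le_hi, hb.hi_le_one, hb.trace_le,
      fun s => by simpa using hb.cover s.swap⟩

/-! ### Moments of quadratic forms in standard Gaussian variables -/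

section Gaussian

theorem iteratedDeriv_exp_sq :
    iteratedDeriv 1 (fun t : ℝ => Real.exp (t ^ 2 / 2)) 0 = 0 ∧
    iteratedDeriv 2 (fun t : ℝ => Real.exp (t ^ 2 / 2)) 0 = 1 ∧
    iteratedDeriv 4 (fun t : ℝ => Real.exp (t ^ 2 / 2)) 0 = 3 := by
  have h0 : ∀ t : ℝ, HasDerivAt (fun t : ℝ => Real.exp (t ^ 2 / 2)) (t * Real.exp (t ^ 2 / 2)) t :=
    fun t => by
      have h := (((hasDerivAt_id t).pow 2).div_const 2).exp
      simp only [id, Pi.pow_apply] at h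
      exact h.congr_deriv (by simp; ring)
  have d1 : iteratedDeriv 1 (fun t : ℝ => Real.exp (t ^ 2 / 2))
      = fun t => t * Real.exp (t ^ 2 / 2) := by
    rw [iteratedDeriv_one]; exact funext fun t => (h0 t).deriv
  have d2 : iteratedDeriv 2 (fun t : ℝ => Real.exp (t ^ 2 / 2))
      = fun t => (1 + t ^ 2) * Real.exp (t ^ 2 / 2) := by
    rw [iteratedDeriv_succ, d1]
    funext t
    refine (((hasDerivAt_id t).mul (h0 t)).congr_deriv ?_).deriv
    simp; ring
  have d3 : iteratedDeriv 3 (fun t : ℝ => Real.exp (t ^ 2 / 2))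
      = fun t => (3 * t + t ^ 3) * Real.exp (t ^ 2 / 2) := by
    rw [iteratedDeriv_succ, d2]
    funext t
    refine (((((hasDerivAt_id t).pow 2).const_add 1).mul (h0 t)).congr_deriv ?_).deriv
    simp; ring
  have d4 : iteratedDeriv 4 (fun t : ℝ => Real.exp (t ^ 2 / 2))
      = fun t => (3 + 6 * t ^ 2 + t ^ 4) * Real.exp (t ^ 2 / 2) := by
    rw [iteratedDeriv_succ, d3]
    funext t
    refine (((((hasDerivAt_id t).const_mul 3).add ((hasDerivAt_id t).pow 3)).mul
      (h0 t)).congr_deriv ?_).deriv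
    simp; ring
  rw [d1, d2, d4]
  simp

/-- The moments of the standard Gaussian law. -/
noncomputable def gaussMoment (k : ℕ) : ℝ := ∫ x, x ^ k ∂gaussianReal 0 1

theorem gaussMoment_eq_iteratedDeriv (k : ℕ) :
    gaussMoment k = iteratedDeriv k (fun t : ℝ => Real.exp (t ^ 2 / 2)) 0 := by
  have h := iteratedDeriv_mgf_zero (X := id) (μ := gaussianReal 0 1)
    (by simp [integrableExpSet_id_gaussianReal]) k
  rw [mgf_id_gaussianReal] at h
  simp only [zero_mul, zero_add, NNReal.coe_one, one_mul] at h
  rw [h]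
  rfl

theorem gaussMoment_zero : gaussMoment 0 = 1 := by simp [gaussMoment]
theorem gaussMoment_one : gaussMoment 1 = 0 := by
  rw [gaussMoment_eq_iteratedDeriv]; exact iteratedDeriv_exp_sq.1
theorem gaussMoment_two : gaussMoment 2 = 1 := by
  rw [gaussMoment_eq_iteratedDeriv]; exact iteratedDeriv_exp_sq.2.1
theorem gaussMoment_four : gaussMoment 4 = 3 := by
  rw [gaussMoment_eq_iteratedDeriv]; exact iteratedDeriv_exp_sq.2.2

theorem integrable_pow_gaussian (k : ℕ) : Integrable (fun x : ℝ => x ^ k) (gaussianReal 0 1) :=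
  integrable_pow_of_mem_interior_integrableExpSet (X := id)
    (by simp [integrableExpSet_id_gaussianReal]) k

variable {n : Type*} [Fintype n]

/-- The law of independent standard Gaussian variables. -/
noncomputable def stdGauss (n : Type*) [Fintype n] : Measure (n → ℝ) :=
  Measure.pi fun _ => gaussianReal 0 1

instance : IsProbabilityMeasure (stdGauss n) := by unfold stdGauss; infer_instance

theorem integrable_monomial (m : n → ℕ) :
    Integrable (fun x : n → ℝ => ∏ p, x p ^ m p) (stdGauss n) :=
  Integrable.fintype_prod (f := fun p (t : ℝ) => t ^ m p) fun p => integrable_pow_gaussian (m p)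

theorem integral_monomial (m : n → ℕ) :
    ∫ x : n → ℝ, ∏ p, x p ^ m p ∂stdGauss n = ∏ p, gaussMoment (m p) :=
  integral_fintype_prod_eq_prod (fun p (t : ℝ) => t ^ m p)

theorem quad_eq_sum (G : Matrix n n ℝ) (x : n → ℝ) :
    x ⬝ᵥ (G *ᵥ x) = ∑ i, ∑ j, G i j * (x i * x j) := by
  simp only [dotProduct, Matrix.mulVec, Finset.mul_sum]
  exact Finset.sum_congr rfl fun i _ => Finset.sum_congr rfl fun j _ => by ring

theorem dotProduct_sq_eq_quad (u x : n → ℝ) :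
    (x ⬝ᵥ u) ^ 2 = x ⬝ᵥ (Matrix.vecMulVec u u *ᵥ x) := by
  rw [Matrix.vecMulVec_mulVec, dotProduct_comm u x]
  simp [dotProduct_smul, sq]

theorem quad_sq_eq_sum (G : Matrix n n ℝ) (x : n → ℝ) :
    (x ⬝ᵥ (G *ᵥ x)) ^ 2
      = ∑ i, ∑ j, ∑ k, ∑ l, G i j * G k l * (x i * x j * (x k * x l)) := by
  rw [quad_eq_sum, sq, Finset.sum_mul]
  refine Finset.sum_congr rfl fun i _ => ?_
  rw [Finset.sum_mul]
  refine Finset.sum_congr rfl fun j _ => ?_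
  rw [Finset.mul_sum]
  refine Finset.sum_congr rfl fun k _ => ?_
  rw [Finset.mul_sum]
  exact Finset.sum_congr rfl fun l _ => by ring

variable [DecidableEq n]

theorem prod_pow_indicator (x : n → ℝ) (i : n) : ∏ p, x p ^ (if i = p then 1 else 0) = x i := by
  simp [pow_ite]

theorem integrable_mul_two (i j : n) :
    Integrable (fun x : n → ℝ => x i * x j) (stdGauss n) := by
  refine (integrable_monomial fun p => (if i = p then 1 else 0) + (if j = p then 1 else 0)).congr
    (Eventually.of_forall fun x => ?_)
  simp only [pow_add, Finset.prod_mul_distrib, prod_pow_indicator]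

theorem integral_mul_two (i j : n) :
    ∫ x : n → ℝ, x i * x j ∂stdGauss n = if i = j then 1 else 0 := by
  have h := integral_monomial (n := n)
    fun p => (if i = p then 1 else 0) + (if j = p then 1 else 0)
  simp only [pow_add, Finset.prod_mul_distrib, prod_pow_indicator] at h
  rw [h]
  split_ifs with hij
  · subst hij
    rw [Finset.prod_eq_single i (fun p _ hp => by simp [Ne.symm hp, gaussMoment_zero]) (by simp)]
    simp [gaussMoment_two]
  · exact Finset.prod_eq_zero (Finset.mem_univ i) (by simp [Ne.symm hij, gaussMoment_one])

theorem integrable_mul_four (i j k l : n) :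
    Integrable (fun x : n → ℝ => x i * x j * (x k * x l)) (stdGauss n) := by
  refine (integrable_monomial fun p => ((if i = p then 1 else 0) + (if j = p then 1 else 0)) +
    ((if k = p then 1 else 0) + (if l = p then 1 else 0))).congr
    (Eventually.of_forall fun x => ?_)
  simp only [pow_add, Finset.prod_mul_distrib, prod_pow_indicator]

/-- Isserlis' formula for fourth moments. -/
theorem integral_mul_four (i j k l : n) :
    ∫ x : n → ℝ, x i * x j * (x k * x l) ∂stdGauss n
      = (if i = j then 1 else 0) * (if k = l then 1 else 0)
        + (if i = k then 1 else 0) * (if j = l then 1 else 0)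
        + (if i = l then 1 else 0) * (if j = k then 1 else 0) := by
  have h := integral_monomial (n := n) fun p =>
    ((if i = p then 1 else 0) + (if j = p then 1 else 0)) +
    ((if k = p then 1 else 0) + (if l = p then 1 else 0))
  simp only [pow_add, Finset.prod_mul_distrib, prod_pow_indicator] at h
  rw [h]
  -- If one index differs from all others, the product has a vanishing factor; otherwise the
  -- indices are all equal or form two pairs.
  have hpair : ∀ a b : n, a ≠ b → ∀ m : n → ℕ, m a = 2 → m b = 2 →
      (∀ p, p ≠ a → p ≠ b → m p = 0) → ∏ p, gaussMoment (m p) = 1 := by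
    intro a b hab m ha hb hm
    rw [Finset.prod_eq_mul a b hab
      (fun p _ hp => by rw [hm p hp.1 hp.2, gaussMoment_zero]) (by simp) (by simp), ha, hb,
      gaussMoment_two, one_mul]
  by_cases hij : i = j
  · subst hij
    by_cases hkl : k = l
    · subst hkl
      by_cases hik : i = k
      · subst hik
        rw [Finset.prod_eq_single i (fun p _ hp => by simp [Ne.symm hp, gaussMoment_zero])
          (by simp)]
        simp [gaussMoment_four]
        norm_num
      · rw [hpair i k hik _ (by simp [Ne.symm hik]) (by simp [hik])
          (fun p h1 h2 => by simp [Ne.symm h1, Ne.symm h2])]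
        simp [hik]
    · by_cases hik : i = k
      · subst hik
        rw [Finset.prod_eq_zero (Finset.mem_univ l) (by simp [hkl, gaussMoment_one])]
        simp [hkl]
      · rw [Finset.prod_eq_zero (Finset.mem_univ k)
          (by simp [hik, Ne.symm hkl, gaussMoment_one])]
        simp [hkl, hik]
  · by_cases hik : i = k
    · subst hik
      by_cases hjl : j = l
      · subst hjl
        rw [hpair i j hij _ (by simp [Ne.symm hij]) (by simp [hij])
          (fun p h1 h2 => by simp [Ne.symm h1, Ne.symm h2])]
        simp [hij]
      · rw [Finset.prod_eq_zero (Finset.mem_univ j)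
          (by simp [hij, Ne.symm hjl, gaussMoment_one])]
        simp [hij, hjl, Ne.symm hij]
    · by_cases hil : i = l
      · subst hil
        by_cases hjk : j = k
        · subst hjk
          rw [hpair i j hij _ (by simp [Ne.symm hij]) (by simp [hij])
            (fun p h1 h2 => by simp [Ne.symm h1, Ne.symm h2])]
          simp [hij]
        · rw [Finset.prod_eq_zero (Finset.mem_univ j)
            (by simp [hij, Ne.symm hjk, gaussMoment_one])]
          simp [hij, hik, hjk]
      · rw [Finset.prod_eq_zero (Finset.mem_univ i)
          (by simp [Ne.symm hij, Ne.symm hik, Ne.symm hil, gaussMoment_one])]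
        simp [hij, hik, hil]

theorem integrable_quad (G : Matrix n n ℝ) :
    Integrable (fun x : n → ℝ => x ⬝ᵥ (G *ᵥ x)) (stdGauss n) := by
  simp only [quad_eq_sum]
  exact integrable_finsetSum _ fun i _ => integrable_finsetSum _ fun j _ =>
    (integrable_mul_two i j).const_mul _

theorem integral_quad (G : Matrix n n ℝ) :
    ∫ x : n → ℝ, x ⬝ᵥ (G *ᵥ x) ∂stdGauss n = G.trace := by
  simp only [quad_eq_sum]
  refine (integral_finsetSum _ fun i _ => integrable_finsetSum _ fun j _ =>
    (integrable_mul_two i j).const_mul _).trans ?_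
  simp only [integral_finsetSum _ fun j _ => (integrable_mul_two _ j).const_mul _,
    integral_const_mul, integral_mul_two]
  simp [Matrix.trace]

theorem integrable_quad_sq (G : Matrix n n ℝ) :
    Integrable (fun x : n → ℝ => (x ⬝ᵥ (G *ᵥ x)) ^ 2) (stdGauss n) := by
  simp only [quad_sq_eq_sum]
  exact integrable_finsetSum _ fun i _ => integrable_finsetSum _ fun j _ =>
    integrable_finsetSum _ fun k _ => integrable_finsetSum _ fun l _ =>
    (integrable_mul_four i j k l).const_mul _

theorem integral_quad_sq (G : Matrix n n ℝ) :
    ∫ x : n → ℝ, (x ⬝ᵥ (G *ᵥ x)) ^ 2 ∂stdGauss n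
      = G.trace ^ 2 + ∑ i, ∑ j, G i j ^ 2 + ∑ i, ∑ j, G i j * G j i := by
  simp only [quad_sq_eq_sum]
  rw [integral_finsetSum _ fun i _ => integrable_finsetSum _ fun j _ =>
    integrable_finsetSum _ fun k _ => integrable_finsetSum _ fun l _ =>
    (integrable_mul_four i j k l).const_mul _]
  have e : ∀ i, ∫ x : n → ℝ, ∑ j, ∑ k, ∑ l, G i j * G k l * (x i * x j * (x k * x l)) ∂stdGauss n
      = G i i * G.trace + ∑ j, G i j ^ 2 + ∑ j, G i j * G j i := by
    intro i
    rw [integral_finsetSum _ fun j _ =>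
      integrable_finsetSum _ fun k _ => integrable_finsetSum _ fun l _ =>
      (integrable_mul_four i j k l).const_mul _]
    have e2 : ∀ j, ∫ x : n → ℝ, ∑ k, ∑ l, G i j * G k l * (x i * x j * (x k * x l)) ∂stdGauss n
        = (if i = j then G i j * G.trace else 0) + G i j ^ 2 + G i j * G j i := by
      intro j
      rw [integral_finsetSum _ fun k _ => integrable_finsetSum _ fun l _ =>
        (integrable_mul_four i j k l).const_mul _]
      simp only [integral_finsetSum _ fun l _ => (integrable_mul_four i j _ l).const_mul _,
        integral_const_mul, integral_mul_four, mul_add, Finset.sum_add_distrib]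
      congr 1
      · congr 1
        · split_ifs with h
          · simp [Matrix.trace, Finset.mul_sum]
          · simp
        · simp [sq]
      · simp
    simp only [e2, Finset.sum_add_distrib]
    simp
  simp only [e, Finset.sum_add_distrib]
  rw [← Finset.sum_mul]
  simp only [Matrix.trace, Matrix.diag_apply, sq]

theorem integrable_quad_sub_trace_sq (G : Matrix n n ℝ) :
    Integrable (fun x : n → ℝ => (x ⬝ᵥ (G *ᵥ x) - G.trace) ^ 2) (stdGauss n) := by
  simp only [sub_sq]
  exact ((integrable_quad_sq G).sub (((integrable_quad G).const_mul 2).mul_const _)).add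
    (integrable_const _)

/-- The variance of a Gaussian quadratic form is at most twice the squared Frobenius norm. -/
theorem integral_quad_sub_trace_sq_le {G : Matrix n n ℝ} {κ : ℝ} (hG : OpBound G κ) :
    ∫ x : n → ℝ, (x ⬝ᵥ (G *ᵥ x) - G.trace) ^ 2 ∂stdGauss n ≤ 2 * Fintype.card n * κ ^ 2 := by
  simp only [sub_sq]
  have i1 : Integrable (fun x : n → ℝ => 2 * (x ⬝ᵥ (G *ᵥ x)) * G.trace) (stdGauss n) :=
    ((integrable_quad G).const_mul 2).mul_const _
  have i2 : Integrable (fun x : n → ℝ => (x ⬝ᵥ (G *ᵥ x)) ^ 2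
      - 2 * (x ⬝ᵥ (G *ᵥ x)) * G.trace) (stdGauss n) := (integrable_quad_sq G).sub i1
  rw [integral_add i2 (integrable_const _), integral_sub (integrable_quad_sq G) i1,
    integral_mul_const, integral_const_mul,
    integral_quad, integral_quad_sq, integral_const]
  have h1 := hG.sum_sq_le
  have h2 : ∑ i, ∑ j, G i j * G j i ≤ ∑ i, ∑ j, G i j ^ 2 := by
    have h3 : ∑ i, ∑ j, G j i ^ 2 = ∑ i, ∑ j, G i j ^ 2 := Finset.sum_comm
    have h4 : ∑ i, ∑ j, G i j * G j i ≤ ∑ i, ∑ j, (G i j ^ 2 + G j i ^ 2) / 2 :=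
      Finset.sum_le_sum fun i _ => Finset.sum_le_sum fun j _ => by
        nlinarith [sq_nonneg (G i j - G j i)]
    refine h4.trans (le_of_eq ?_)
    simp only [← Finset.sum_div, Finset.sum_add_distrib, h3]
    ring
  simp only [probReal_univ, one_smul]
  nlinarith

theorem integrable_dotProduct_sq (u : n → ℝ) :
    Integrable (fun x : n → ℝ => (x ⬝ᵥ u) ^ 2) (stdGauss n) := by
  simp only [dotProduct_sq_eq_quad]
  exact integrable_quad _

theorem integral_dotProduct_sq (u : n → ℝ) :
    ∫ x : n → ℝ, (x ⬝ᵥ u) ^ 2 ∂stdGauss n = u ⬝ᵥ u := by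
  simp only [dotProduct_sq_eq_quad]
  rw [integral_quad, Matrix.trace_vecMulVec]

end Gaussian

/-! ### Uniform bounds over a bracketed family -/

section Uniform

theorem integrable_sqrt_of_nonneg {Ω : Type*} [MeasurableSpace Ω] {P : Measure Ω}
    [IsProbabilityMeasure P] {f : Ω → ℝ} (hf : Integrable f P) (h0 : ∀ x, 0 ≤ f x) :
    Integrable (fun x => √(f x)) P := by
  refine (hf.add (integrable_const 1)).mono' (hf.aestronglyMeasurable.aemeasurable.sqrt
    |>.aestronglyMeasurable) (Eventually.of_forall fun x => ?_)
  rw [Real.norm_of_nonneg (Real.sqrt_nonneg _)]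
  have := Real.sq_sqrt (h0 x)
  simp only [Pi.add_apply]
  nlinarith [sq_nonneg (√(f x) - 1)]

theorem integrable_sqrt_mul {Ω : Type*} [MeasurableSpace Ω] {P : Measure Ω} {f g : Ω → ℝ}
    (hf : Integrable f P) (hg : Integrable g P) (f0 : ∀ x, 0 ≤ f x) (g0 : ∀ x, 0 ≤ g x) :
    Integrable (fun x => √(f x * g x)) P := by
  refine (hf.add hg).mono' ((hf.aestronglyMeasurable.aemeasurable.mul
    hg.aestronglyMeasurable.aemeasurable).sqrt.aestronglyMeasurable)
    (Eventually.of_forall fun x => ?_)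
  rw [Real.norm_of_nonneg (Real.sqrt_nonneg _), Pi.add_apply]
  refine Real.sqrt_le_iff.2 ⟨add_nonneg (f0 x) (g0 x), ?_⟩
  nlinarith [mul_nonneg (f0 x) (g0 x), sq_nonneg (f x), sq_nonneg (g x)]

/-- The Cauchy-Schwarz inequality. -/
theorem integral_sqrt_mul_le {Ω : Type*} [MeasurableSpace Ω] {P : Measure Ω} {f g : Ω → ℝ}
    (hf : Integrable f P) (hg : Integrable g P) (f0 : ∀ x, 0 ≤ f x) (g0 : ∀ x, 0 ≤ g x) :
    ∫ x, √(f x * g x) ∂P ≤ √((∫ x, f x ∂P) * ∫ x, g x ∂P) := by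
  have hL : ∀ {f : Ω → ℝ}, Integrable f P → (∀ x, 0 ≤ f x) →
      MemLp (fun x => √(f x)) (ENNReal.ofReal 2) P := by
    intro f hf f0
    rw [show ENNReal.ofReal 2 = 2 by simp,
      memLp_two_iff_integrable_sq hf.aestronglyMeasurable.aemeasurable.sqrt.aestronglyMeasurable]
    simpa only [Real.sq_sqrt (f0 _)] using hf
  have h := integral_mul_le_Lp_mul_Lq_of_nonneg (μ := P) Real.HolderConjugate.two_two
    (Eventually.of_forall fun x => Real.sqrt_nonneg (f x))
    (Eventually.of_forall fun x => Real.sqrt_nonneg (g x)) (hL hf f0) (hL hg g0)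
  simp only [← Real.sqrt_mul (f0 _), Real.rpow_two, Real.sq_sqrt (f0 _), Real.sq_sqrt (g0 _),
    ← Real.sqrt_eq_rpow] at h
  rwa [← Real.sqrt_mul (integral_nonneg f0)] at h

theorem integral_sqrt_le {Ω : Type*} [MeasurableSpace Ω] {P : Measure Ω} [IsProbabilityMeasure P]
    {f : Ω → ℝ} (hf : Integrable f P) (f0 : ∀ x, 0 ≤ f x) :
    ∫ x, √(f x) ∂P ≤ √(∫ x, f x ∂P) := by
  simpa using integral_sqrt_mul_le hf (integrable_const (1 : ℝ)) f0 fun _ => zero_le_one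

variable {n : Type*} [Fintype n] {J : ℕ}

/-- The root of the sum of squares of finitely many centered quadratic forms. -/
noncomputable def quadDev (F : Fin J → Matrix n n ℝ) (x : n → ℝ) : ℝ :=
  √(∑ i, (x ⬝ᵥ (F i *ᵥ x) - (F i).trace) ^ 2)

theorem quadDev_nonneg (F : Fin J → Matrix n n ℝ) (x : n → ℝ) : 0 ≤ quadDev F x :=
  Real.sqrt_nonneg _

theorem abs_quad_sub_trace_le_quadDev (F : Fin J → Matrix n n ℝ) (x : n → ℝ) (i : Fin J) :
    |x ⬝ᵥ (F i *ᵥ x) - (F i).trace| ≤ quadDev F x :=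
  Real.abs_le_sqrt (Finset.single_le_sum
    (f := fun i => (x ⬝ᵥ (F i *ᵥ x) - (F i).trace) ^ 2) (fun _ _ => sq_nonneg _)
    (Finset.mem_univ i))

theorem quad_sandwich {T : Matrix n n ℝ} (hT : 0 ≤ T) (D : Matrix n n ℝ) (x : n → ℝ) :
    x ⬝ᵥ ((T * D * T) *ᵥ x) = (T *ᵥ x) ⬝ᵥ (D *ᵥ (T *ᵥ x)) := by
  rw [← Matrix.mulVec_mulVec, ← Matrix.mulVec_mulVec,
    dotProduct_mulVec_comm (transpose_eq_of_nonneg hT), dotProduct_comm]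

theorem le_smul_one_of_le_one {n : Type*} [DecidableEq n] {A : Matrix n n ℝ} (h : A ≤ 1) :
    A ≤ (1 : ℝ) • (1 : Matrix n n ℝ) := by
  rwa [one_smul]

/-- The envelope of the centered quadratic forms `xᵀ T W x - tr (T W)` over a bracketed family
of matrices `W`; see `abs_quad_le_quadEnvelope`. -/
noncomputable def quadEnvelope (T : Matrix n n ℝ) (lo hi : Fin J → Matrix n n ℝ) (lam t : ℝ)
    (x : n → ℝ) : ℝ :=
  quadDev (fun i => T * hi i) x + √((t + quadDev (fun i => hi i - lo i) x) *
    (lam ^ 2 * t + quadDev (fun i => T * (hi i - lo i) * T) x)) + lam * t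

/-- The envelope of the squared bilinear forms `(xᵀ T W w)²` over a bracketed family of
matrices `W`; see `sq_bilin_le_linEnvelope`. -/
noncomputable def linEnvelope (T : Matrix n n ℝ) (lo hi : Fin J → Matrix n n ℝ) (lam t : ℝ)
    (w x : n → ℝ) : ℝ :=
  2 * ∑ i, (x ⬝ᵥ ((T * hi i) *ᵥ w)) ^ 2 + 2 * (w ⬝ᵥ w) *
    (lam ^ 2 * t + quadDev (fun i => T * (hi i - lo i) * T) x)

theorem linEnvelope_nonneg {T : Matrix n n ℝ} {lo hi : Fin J → Matrix n n ℝ} {lam t : ℝ}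
    (ht : 0 ≤ t) (w x : n → ℝ) : 0 ≤ linEnvelope T lo hi lam t w x := by
  have h1 := dotProduct_self_nonneg' w
  have h2 := quadDev_nonneg (fun i => T * (hi i - lo i) * T) x
  have h3 : 0 ≤ ∑ i, (x ⬝ᵥ ((T * hi i) *ᵥ w)) ^ 2 := Finset.sum_nonneg fun _ _ => sq_nonneg _
  unfold linEnvelope
  positivity

variable [DecidableEq n]

theorem integrable_quadDev (F : Fin J → Matrix n n ℝ) :
    Integrable (quadDev F) (stdGauss n) :=
  integrable_sqrt_of_nonneg (integrable_finsetSum _ fun i _ => integrable_quad_sub_trace_sq (F i))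
    fun _ => Finset.sum_nonneg fun _ _ => sq_nonneg _

theorem integral_quadDev_le {F : Fin J → Matrix n n ℝ} {κ : ℝ} (hκ : 0 ≤ κ)
    (hF : ∀ i, OpBound (F i) κ) :
    ∫ x, quadDev F x ∂stdGauss n ≤ κ * √(2 * J * Fintype.card n) := by
  refine (integral_sqrt_le
    (integrable_finsetSum _ fun i _ => integrable_quad_sub_trace_sq (F i))
    fun _ => Finset.sum_nonneg fun _ _ => sq_nonneg _).trans ?_
  rw [integral_finsetSum _ fun i _ => integrable_quad_sub_trace_sq (F i)]
  refine Real.sqrt_le_iff.2 ⟨by positivity, ?_⟩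
  rw [mul_pow, Real.sq_sqrt (by positivity)]
  calc _ ≤ ∑ _i : Fin J, 2 * (Fintype.card n : ℝ) * κ ^ 2 :=
        Finset.sum_le_sum fun i _ => integral_quad_sub_trace_sq_le (hF i)
    _ = _ := by simp; ring

section

variable {X : Type*} {W : X → Matrix n n ℝ} {lo hi : Fin J → Matrix n n ℝ} {t lam : ℝ}
  {T : Matrix n n ℝ}

theorem IsBracketing.hi_nonneg (hb : IsBracketing W lo hi t) (i : Fin J) : 0 ≤ hi i :=
  (hb.lo_nonneg i).trans (hb.lo_le_hi i)

theorem IsBracketing.width_le_one (hb : IsBracketing W lo hi t) (i : Fin J) : hi i - lo i ≤ 1 :=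
  (sub_le_self _ (hb.lo_nonneg i)).trans (hb.hi_le_one i)

theorem IsBracketing.width_nonneg (hb : IsBracketing W lo hi t) (i : Fin J) : 0 ≤ hi i - lo i :=
  sub_nonneg.2 (hb.lo_le_hi i)

/-- A member of a bracket differs from its upper end by `0 ≤ Δ ≤ hi - lo`, and
`|xᵀ T Δ z|² ≤ (xᵀ T Δ T x) (zᵀ Δ z)` is monotone in `Δ`. -/
theorem IsBracketing.exists_sq_bilin_le (hb : IsBracketing W lo hi t) (hT : 0 ≤ T)
    (hT1 : T ≤ lam • (1 : Matrix n n ℝ)) (s : X) :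
    ∃ i, lo i ≤ W s ∧ W s ≤ hi i ∧ ∀ x z : n → ℝ,
      (x ⬝ᵥ ((T * (hi i - W s)) *ᵥ z)) ^ 2
        ≤ (lam ^ 2 * t + quadDev (fun i => T * (hi i - lo i) * T) x)
          * (z ⬝ᵥ ((hi i - W s) *ᵥ z)) := by
  obtain ⟨i, h1, h2⟩ := hb.cover s
  refine ⟨i, h1, h2, fun x z => ?_⟩
  have hD : 0 ≤ hi i - W s := sub_nonneg.2 h2
  have hDle : hi i - W s ≤ hi i - lo i := sub_le_sub_left h1 _
  have e : x ⬝ᵥ ((T * (hi i - W s)) *ᵥ z) = (T *ᵥ x) ⬝ᵥ ((hi i - W s) *ᵥ z) := by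
    rw [← Matrix.mulVec_mulVec, dotProduct_mulVec_comm (transpose_eq_of_nonneg hT),
      dotProduct_comm]
  rw [e]
  refine (dotProduct_mulVec_sq_le hD _ _).trans ?_
  refine mul_le_mul_of_nonneg_right ?_ (quad_nonneg hD z)
  have h3 := quad_mono hDle (T *ᵥ x)
  rw [← quad_sandwich hT (hi i - lo i)] at h3
  have h4 := abs_quad_sub_trace_le_quadDev (fun i => T * (hi i - lo i) * T) x i
  have h5 := (trace_sandwich_le hT hT1 (hb.width_nonneg i)).trans
    (mul_le_mul_of_nonneg_left (hb.trace_le i) (sq_nonneg lam))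
  have h6 := (abs_le.1 h4).2
  linarith

theorem IsBracketing.bound_nonneg (hb : IsBracketing W lo hi t) (s : X) : 0 ≤ t := by
  obtain ⟨i, _⟩ := hb.cover s
  exact (Matrix.nonneg_iff_posSemidef.mp (hb.width_nonneg i)).trace_nonneg.trans (hb.trace_le i)

theorem abs_quad_le_quadEnvelope (hb : IsBracketing W lo hi t) (hlam : 0 ≤ lam) (hT : 0 ≤ T)
    (hT1 : T ≤ lam • (1 : Matrix n n ℝ)) (s : X) (x : n → ℝ) :
    |x ⬝ᵥ ((T * W s) *ᵥ x) - (T * W s).trace| ≤ quadEnvelope T lo hi lam t x := by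
  have ht := hb.bound_nonneg s
  obtain ⟨i, h1, h2, h⟩ := hb.exists_sq_bilin_le hT hT1 s
  have hD : 0 ≤ hi i - W s := sub_nonneg.2 h2
  have hDle : hi i - W s ≤ hi i - lo i := sub_le_sub_left h1 _
  have e1 : x ⬝ᵥ ((T * (hi i - W s)) *ᵥ x)
      = x ⬝ᵥ ((T * hi i) *ᵥ x) - x ⬝ᵥ ((T * W s) *ᵥ x) := by
    rw [mul_sub, Matrix.sub_mulVec, dotProduct_sub]
  have e2 : (T * (hi i - W s)).trace = (T * hi i).trace - (T * W s).trace := by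
    rw [mul_sub, Matrix.trace_sub]
  have b1 := abs_quad_sub_trace_le_quadDev (fun i => T * hi i) x i
  have b2 : |x ⬝ᵥ ((T * (hi i - W s)) *ᵥ x)| ≤ √((t + quadDev (fun i => hi i - lo i) x) *
      (lam ^ 2 * t + quadDev (fun i => T * (hi i - lo i) * T) x)) := by
    refine Real.abs_le_sqrt ((h x x).trans ?_)
    rw [mul_comm]
    refine mul_le_mul_of_nonneg_right ?_ (add_nonneg (by positivity) (quadDev_nonneg _ _))
    have h3 := quad_mono hDle x
    have h4 := (abs_le.1 (abs_quad_sub_trace_le_quadDev (fun i => hi i - lo i) x i)).2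
    have h5 := hb.trace_le i
    linarith
  have b3 : (T * (hi i - W s)).trace ≤ lam * t := by
    have h3 := trace_mul_mono hT1 hD
    have h4 := trace_mono hDle
    have h5 := hb.trace_le i
    simp only [Matrix.smul_mul, one_mul, Matrix.trace_smul, smul_eq_mul] at h3
    exact h3.trans (mul_le_mul_of_nonneg_left (h4.trans h5) hlam)
  have b4 : 0 ≤ (T * (hi i - W s)).trace := trace_mul_nonneg hT hD
  rw [abs_le] at b1 b2 ⊢
  unfold quadEnvelope
  constructor <;> linarith [b1.1, b1.2, b2.1, b2.2]

theorem sq_bilin_le_linEnvelope (hb : IsBracketing W lo hi t) (hT : 0 ≤ T)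
    (hT1 : T ≤ lam • (1 : Matrix n n ℝ)) (h0 : ∀ s, 0 ≤ W s) (s : X) (w x : n → ℝ) :
    (x ⬝ᵥ ((T * W s) *ᵥ w)) ^ 2 ≤ linEnvelope T lo hi lam t w x := by
  have ht := hb.bound_nonneg s
  obtain ⟨i, h1, h2, h⟩ := hb.exists_sq_bilin_le hT hT1 s
  have e1 : x ⬝ᵥ ((T * (hi i - W s)) *ᵥ w)
      = x ⬝ᵥ ((T * hi i) *ᵥ w) - x ⬝ᵥ ((T * W s) *ᵥ w) := by
    rw [mul_sub, Matrix.sub_mulVec, dotProduct_sub]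
  have b1 : w ⬝ᵥ ((hi i - W s) *ᵥ w) ≤ w ⬝ᵥ w := by
    have := quad_mono ((sub_le_self (hi i) (h0 s)).trans (hb.hi_le_one i)) w
    rwa [Matrix.one_mulVec] at this
  have b2 := (h x w).trans (mul_le_mul_of_nonneg_left b1
    (add_nonneg (by positivity) (quadDev_nonneg _ _)))
  have b3 : (x ⬝ᵥ ((T * hi i) *ᵥ w)) ^ 2 ≤ ∑ i, (x ⬝ᵥ ((T * hi i) *ᵥ w)) ^ 2 :=
    Finset.single_le_sum (f := fun i => (x ⬝ᵥ ((T * hi i) *ᵥ w)) ^ 2)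
      (fun _ _ => sq_nonneg _) (Finset.mem_univ i)
  rw [e1] at b2
  unfold linEnvelope
  nlinarith [sq_nonneg (x ⬝ᵥ ((T * hi i) *ᵥ w) + (x ⬝ᵥ ((T * hi i) *ᵥ w)
    - x ⬝ᵥ ((T * W s) *ᵥ w)))]

theorem integrable_quadEnvelope (ht : 0 ≤ t) :
    Integrable (quadEnvelope T lo hi lam t) (stdGauss n) :=
  ((integrable_quadDev _).add (integrable_sqrt_mul ((integrable_const t).add (integrable_quadDev _))
    ((integrable_const (lam ^ 2 * t)).add (integrable_quadDev _))
    (fun x => add_nonneg ht (quadDev_nonneg _ x))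
    (fun x => add_nonneg (by positivity) (quadDev_nonneg _ x)))).add (integrable_const _)

theorem integrable_linEnvelope (w : n → ℝ) :
    Integrable (linEnvelope T lo hi lam t w) (stdGauss n) :=
  ((integrable_finsetSum _ fun _ _ => integrable_dotProduct_sq _).const_mul 2).add
    (((integrable_const _).add (integrable_quadDev _)).const_mul _)

theorem IsBracketing.opBound_hi (hb : IsBracketing W lo hi t) (hT : 0 ≤ T)
    (hT1 : T ≤ lam • (1 : Matrix n n ℝ)) (i : Fin J) : OpBound (T * hi i) lam := by
  have := (opBound_of_le_smul_one hT hT1).mul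
    (opBound_of_le_smul_one (hb.hi_nonneg i) (le_smul_one_of_le_one (hb.hi_le_one i)))
  rwa [mul_one] at this

theorem IsBracketing.integral_quadDev_sandwich_le (hb : IsBracketing W lo hi t) (hT : 0 ≤ T)
    (hT1 : T ≤ lam • (1 : Matrix n n ℝ)) :
    ∫ x, (lam ^ 2 * t + quadDev (fun i => T * (hi i - lo i) * T) x) ∂stdGauss n
      ≤ lam ^ 2 * (t + √(2 * J * Fintype.card n)) := by
  have h := integral_quadDev_le (F := fun i => T * (hi i - lo i) * T) (sq_nonneg lam) fun i =>
    opBound_of_le_smul_one (sandwich_nonneg hT (hb.width_nonneg i))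
      (sandwich_le hT hT1 (hb.width_le_one i) (hb.width_nonneg i))
  rw [integral_add (integrable_const _) (integrable_quadDev _), integral_const, probReal_univ,
    one_smul]
  linarith

theorem IsBracketing.integral_quadEnvelope_le (hb : IsBracketing W lo hi t) (ht : 0 ≤ t)
    (hlam : 0 ≤ lam) (hT : 0 ≤ T) (hT1 : T ≤ lam • (1 : Matrix n n ℝ)) :
    ∫ x, quadEnvelope T lo hi lam t x ∂stdGauss n
      ≤ 2 * lam * (t + √(2 * J * Fintype.card n)) := by
  set R := √(2 * (J : ℝ) * Fintype.card n) with hR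
  have hR0 : 0 ≤ R := Real.sqrt_nonneg _
  have iG := (integrable_const (μ := stdGauss n) t).add
    (integrable_quadDev (fun i => hi i - lo i))
  have iH := (integrable_const (μ := stdGauss n) (lam ^ 2 * t)).add
    (integrable_quadDev (fun i => T * (hi i - lo i) * T))
  have g0 : ∀ x, 0 ≤ t + quadDev (fun i => hi i - lo i) x :=
    fun x => add_nonneg ht (quadDev_nonneg _ x)
  have h0 : ∀ x, 0 ≤ lam ^ 2 * t + quadDev (fun i => T * (hi i - lo i) * T) x :=
    fun x => add_nonneg (by positivity) (quadDev_nonneg _ x)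
  have b1 := integral_quadDev_le (F := fun i => T * hi i) hlam fun i => hb.opBound_hi hT hT1 i
  have b2 : ∫ x, (t + quadDev (fun i => hi i - lo i) x) ∂stdGauss n ≤ t + R := by
    have h := integral_quadDev_le (F := fun i => hi i - lo i) zero_le_one fun i =>
      opBound_of_le_smul_one (hb.width_nonneg i) (le_smul_one_of_le_one (hb.width_le_one i))
    rw [integral_add (integrable_const _) (integrable_quadDev _), integral_const, probReal_univ,
      one_smul]
    linarith
  have b3 := hb.integral_quadDev_sandwich_le hT hT1
  have b4 := (integral_sqrt_mul_le iG iH g0 h0).trans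
    (Real.sqrt_le_sqrt (mul_le_mul b2 b3 (integral_nonneg h0) (by positivity)))
  have e : √((t + R) * (lam ^ 2 * (t + R))) = lam * (t + R) := by
    rw [show (t + R) * (lam ^ 2 * (t + R)) = (lam * (t + R)) ^ 2 by ring,
      Real.sqrt_sq (by positivity)]
  rw [← hR, e] at b4
  have iS := integrable_sqrt_mul iG iH g0 h0
  have e2 : ∫ x, quadEnvelope T lo hi lam t x ∂stdGauss n
      = ∫ x, quadDev (fun i => T * hi i) x ∂stdGauss n
        + ∫ x, √((t + quadDev (fun i => hi i - lo i) x) *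
          (lam ^ 2 * t + quadDev (fun i => T * (hi i - lo i) * T) x)) ∂stdGauss n + lam * t := by
    unfold quadEnvelope
    have := integral_add ((integrable_quadDev (fun i => T * hi i)).add iS)
      (integrable_const (lam * t))
    simp only [Pi.add_apply, integral_const, probReal_univ, one_smul] at this
    rw [this]
    congr 1
    exact integral_add (integrable_quadDev (fun i => T * hi i)) iS
  rw [e2]
  simp only [Pi.add_apply] at b4
  linarith

theorem IsBracketing.integral_linEnvelope_le (hb : IsBracketing W lo hi t)
    (hT : 0 ≤ T) (hT1 : T ≤ lam • (1 : Matrix n n ℝ)) (w : n → ℝ) :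
    ∫ x, linEnvelope T lo hi lam t w x ∂stdGauss n
      ≤ 2 * (w ⬝ᵥ w) * lam ^ 2 * (J + t + √(2 * J * Fintype.card n)) := by
  have iL := integrable_finsetSum (μ := stdGauss n) Finset.univ
    fun i (_ : i ∈ Finset.univ) => integrable_dotProduct_sq ((T * hi i) *ᵥ w)
  have iH := (integrable_const (μ := stdGauss n) (lam ^ 2 * t)).add
    (integrable_quadDev (fun i => T * (hi i - lo i) * T))
  have b3 := hb.integral_quadDev_sandwich_le hT hT1
  have hw := dotProduct_self_nonneg' w
  have b1 : ∫ x, ∑ i, (x ⬝ᵥ ((T * hi i) *ᵥ w)) ^ 2 ∂stdGauss n ≤ J * (lam ^ 2 * (w ⬝ᵥ w)) := by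
    rw [integral_finsetSum _ fun i _ => integrable_dotProduct_sq ((T * hi i) *ᵥ w)]
    calc _ ≤ ∑ _i : Fin J, lam ^ 2 * (w ⬝ᵥ w) := Finset.sum_le_sum fun i _ => by
          rw [integral_dotProduct_sq]; exact hb.opBound_hi hT hT1 i w
      _ = _ := by simp
  have e2 : ∫ x, linEnvelope T lo hi lam t w x ∂stdGauss n
      = 2 * ∫ x, ∑ i, (x ⬝ᵥ ((T * hi i) *ᵥ w)) ^ 2 ∂stdGauss n + 2 * (w ⬝ᵥ w) *
        ∫ x, (lam ^ 2 * t + quadDev (fun i => T * (hi i - lo i) * T) x) ∂stdGauss n := by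
    rw [← integral_const_mul, ← integral_const_mul]
    exact integral_add (iL.const_mul 2) (iH.const_mul _)
  rw [e2]
  have := mul_le_mul_of_nonneg_left b3 (by positivity : 0 ≤ 2 * (w ⬝ᵥ w))
  linarith

end

end Uniform

/-! ### Sample quantiles -/

section Quantile

variable {κ : Type*} [Fintype κ]

/-- Chebyshev's inequality for counts. -/
theorem card_mul_sq_le {p : κ → Prop} {y : κ → ℝ} {x : ℝ} (h : ∀ k, p k → x ^ 2 ≤ y k ^ 2) :
    (Nat.card {k // p k} : ℝ) * x ^ 2 ≤ ∑ k, y k ^ 2 := by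
  classical
  rw [Nat.card_eq_fintype_card, Fintype.card_subtype]
  calc _ = ∑ _k ∈ Finset.univ.filter p, x ^ 2 := by simp
    _ ≤ ∑ k ∈ Finset.univ.filter p, y k ^ 2 :=
        Finset.sum_le_sum fun k hk => h k (Finset.mem_filter.1 hk).2
    _ ≤ _ := Finset.sum_le_univ_sum_of_nonneg fun k => sq_nonneg _

theorem card_le_add_card_gt (y : κ → ℝ) (x : ℝ) :
    (Nat.card {k // y k ≤ x} : ℝ) + Nat.card {k // x < y k} = Fintype.card κ := by
  classical
  simp only [Nat.card_eq_fintype_card, Fintype.card_subtype]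
  have := Finset.card_filter_add_card_filter_not (s := (Finset.univ : Finset κ)) fun k => y k ≤ x
  simp only [not_le] at this
  exact_mod_cast this

/-- A sample quantile that is not extreme is at most of the order of the root mean square. -/
theorem quantile_sq_le {y : κ → ℝ} {q τ : ℝ} (hτ : 0 < τ) (hq : τ / 2 ≤ q)
    (hq' : τ / 2 ≤ 1 - q) :
    quantile y q ^ 2 ≤ 2 / (τ * Fintype.card κ) * ∑ k, y k ^ 2 := by
  rcases isEmpty_or_nonempty κ with hκ | hκ
  · -- With no observations the set in the definition of the quantile is empty, as `0 < q`.
    have hq0 : ¬ q ≤ 0 := by linarith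
    simp [quantile, hq0]
  have hn : (0 : ℝ) < Fintype.card κ := by exact_mod_cast Fintype.card_pos
  set V := ∑ k, y k ^ 2 with hV
  have hV0 : 0 ≤ V := Finset.sum_nonneg fun _ _ => sq_nonneg _
  set ρ := √(2 / (τ * Fintype.card κ) * V) with hρ
  have hρ2 : ρ ^ 2 = 2 / (τ * Fintype.card κ) * V := Real.sq_sqrt (by positivity)
  have hρ0 : 0 ≤ ρ := Real.sqrt_nonneg _
  have hρn : τ / 2 * Fintype.card κ * ρ ^ 2 = V := by rw [hρ2]; field_simp
  have hlow : ∀ x ∈ {x : ℝ | q ≤ (Nat.card {k : κ // y k ≤ x} : ℝ) / Fintype.card κ},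
      -ρ ≤ x := by
    intro x hx
    by_contra! hcon
    have h1 := card_mul_sq_le (p := fun k => y k ≤ x) (y := y) (x := x)
      fun k hk => by nlinarith
    have h2 : q * Fintype.card κ ≤ Nat.card {k : κ // y k ≤ x} := (le_div_iff₀ hn).1 hx
    have h3 : ρ ^ 2 < x ^ 2 := by nlinarith
    have h4 : τ / 2 * Fintype.card κ ≤ Nat.card {k : κ // y k ≤ x} :=
      (mul_le_mul_of_nonneg_right hq hn.le).trans h2
    have h5 : 0 < τ / 2 * (Fintype.card κ : ℝ) := by positivity
    nlinarith
  have hup : ∀ x, ρ < x → x ∈ {x : ℝ | q ≤ (Nat.card {k : κ // y k ≤ x} : ℝ) / Fintype.card κ} := by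
    intro x hx
    refine (le_div_iff₀ hn).2 ?_
    have h1 := card_mul_sq_le (p := fun k => x < y k) (y := y) (x := x)
      fun k hk => by nlinarith
    have h2 := card_le_add_card_gt y x
    have h3 : ρ ^ 2 < x ^ 2 := by nlinarith
    by_contra! hcon
    have h4 : τ / 2 * Fintype.card κ ≤ Nat.card {k : κ // x < y k} := by nlinarith
    have h5 : 0 < τ / 2 * (Fintype.card κ : ℝ) := by positivity
    nlinarith
  rw [← hρ2]
  refine sq_le_sq' (le_csInf ⟨ρ + 1, hup _ (by linarith)⟩ hlow) ?_
  refine le_of_forall_gt_imp_ge_of_dense fun x hx => csInf_le ⟨-ρ, hlow⟩ (hup x hx)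

theorem hyperRange_sq_le {r c : ℕ} {K : Fin r × Fin c → ℕ} {τ : ℝ} (hτ : τ ∈ Set.Ioc (0 : ℝ) 1)
    {y : Obs K → ℝ} {h : Hyper} (hh : h ∈ hyperRange τ y) :
    h.1 ^ 2 ≤ 2 / (τ * Fintype.card (Obs K)) * ∑ k, y k ^ 2 := by
  have h1 := quantile_sq_le (y := y) (q := τ / 2) hτ.1 le_rfl (by linarith [hτ.2])
  have h2 := quantile_sq_le (y := y) (q := 1 - τ / 2) hτ.1 (by linarith [hτ.2]) (by linarith)
  obtain ⟨ha, hb⟩ := hh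
  rcases le_total 0 h.1 with h0 | h0
  · exact (pow_le_pow_left₀ h0 hb 2).trans h2
  · refine le_trans ?_ h1
    nlinarith

end Quantile

/-! ### Loss and unbiased risk estimate in whitened coordinates -/

section Identity

variable {r c : ℕ} (K : Fin r × Fin c → ℕ)

/-- The loss matrix in whitened coordinates, `M^{1/2} Q M^{1/2}`. -/
noncomputable def whiteLoss : Matrix (Obs K) (Obs K) ℝ := errSqrt K * lossMat K * errSqrt K

/-- Whitening `M^{-1/2} v` of a vector over the non-empty cells. -/
noncomputable def whiten (v : Obs K → ℝ) : Obs K → ℝ := fun p => √(K p : ℝ) * v p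

/-- The data vector `η + σ M^{1/2} x`. -/
noncomputable def dataOf (σ : ℝ) (η : Obs K → ℝ) (x : Obs K → ℝ) : Obs K → ℝ :=
  fun p => η p + σ * (√(K p : ℝ))⁻¹ * x p

theorem sqrt_cell_pos (p : Obs K) : 0 < √(K p : ℝ) := Real.sqrt_pos.2 (by exact_mod_cast p.2)

theorem errSqrt_mulVec_whiten (v : Obs K → ℝ) : errSqrt K *ᵥ whiten K v = v := by
  funext p
  rw [errSqrt, Matrix.mulVec_diagonal, whiten, inv_mul_cancel_left₀ (sqrt_cell_pos K p).ne']

theorem dataOf_sub (σ : ℝ) (η x : Obs K → ℝ) : dataOf K σ η x - η = errSqrt K *ᵥ (σ • x) := by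
  funext p
  rw [errSqrt, Matrix.mulVec_diagonal]
  simp only [dataOf, Pi.sub_apply, Pi.smul_apply, smul_eq_mul]
  ring

/-- The whitened residual `M^{-1/2} (y - m 1)` of the data. -/
noncomputable def whiteResid (σ : ℝ) (η x : Obs K → ℝ) (m : ℝ) : Obs K → ℝ :=
  σ • x + whiten K η - m • whiten K 1

theorem dataOf_sub_const (σ : ℝ) (η x : Obs K → ℝ) (m : ℝ) :
    (dataOf K σ η x - fun _ => m) = errSqrt K *ᵥ whiteResid K σ η x m := by
  rw [whiteResid, Matrix.mulVec_sub, Matrix.mulVec_add, Matrix.mulVec_smul _ m,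
    errSqrt_mulVec_whiten, errSqrt_mulVec_whiten, ← dataOf_sub K σ η x]
  funext p
  simp

theorem shrink_dataOf_sub (σ : ℝ) (η x : Obs K → ℝ) (h : Hyper) :
    shrink K (dataOf K σ η x) h - η
      = errSqrt K *ᵥ (σ • x - whitePrec K h.2 *ᵥ whiteResid K σ η x h.1) := by
  rw [shrink, dataOf_sub_const, sub_right_comm, dataOf_sub, Matrix.mulVec_sub,
    ← errSqrt_mul_self, whitePrec]
  simp only [Matrix.mulVec_mulVec, Matrix.mul_assoc]

theorem lossMat_nonneg : 0 ≤ lossMat K := by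
  rw [Matrix.nonneg_iff_posSemidef, lossMat]
  simpa using Matrix.posSemidef_conjTranspose_mul_self (completeMat K)

theorem whiteLoss_nonneg : 0 ≤ whiteLoss K := by
  have := congr_nonneg (lossMat_nonneg K) (errSqrt K)
  rwa [errSqrt_transpose] at this

theorem quad_errSqrt (A : Matrix (Obs K) (Obs K) ℝ) (u v : Obs K → ℝ) :
    (errSqrt K *ᵥ u) ⬝ᵥ (A *ᵥ (errSqrt K *ᵥ v))
      = u ⬝ᵥ ((errSqrt K * A * errSqrt K) *ᵥ v) := by
  rw [← Matrix.mulVec_mulVec, ← Matrix.mulVec_mulVec, Matrix.dotProduct_mulVec u,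
    ← Matrix.mulVec_transpose, errSqrt_transpose]

theorem lossQ_dataOf (σ : ℝ) (η x : Obs K → ℝ) (h : Hyper) :
    lossQ K η (shrink K (dataOf K σ η x) h) = ((r : ℝ) * c)⁻¹ *
      ((σ • x - whitePrec K h.2 *ᵥ whiteResid K σ η x h.1) ⬝ᵥ
        (whiteLoss K *ᵥ (σ • x - whitePrec K h.2 *ᵥ whiteResid K σ η x h.1))) := by
  rw [lossQ, shrink_dataOf_sub, quad_errSqrt, whiteLoss]

theorem ure_dataOf (σ : ℝ) (η x : Obs K → ℝ) (h : Hyper) :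
    ure K σ (dataOf K σ η x) h = ((r : ℝ) * c)⁻¹ *
      (σ ^ 2 * (lossMat K * errCov K).trace
        - 2 * σ ^ 2 * (whiteLoss K * whitePrec K h.2).trace
        + (whitePrec K h.2 *ᵥ whiteResid K σ η x h.1) ⬝ᵥ
          (whiteLoss K *ᵥ (whitePrec K h.2 *ᵥ whiteResid K σ η x h.1))) := by
  have hWt := transpose_eq_of_nonneg (whitePrec_nonneg K h.2)
  have e1 : (margPrec K h.2 * errCov K * lossMat K * errCov K).trace
      = (whiteLoss K * whitePrec K h.2).trace := by
    rw [← errSqrt_mul_self, whiteLoss, whitePrec]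
    calc _ = ((margPrec K h.2 * errSqrt K) * (errSqrt K * lossMat K * errSqrt K * errSqrt K)).trace :=
          by simp only [Matrix.mul_assoc]
      _ = _ := by rw [Matrix.trace_mul_comm]; simp only [Matrix.mul_assoc]
  have e2 : errSqrt K * (margPrec K h.2 * errCov K * lossMat K * errCov K * margPrec K h.2)
      * errSqrt K = whitePrec K h.2 * whiteLoss K * whitePrec K h.2 := by
    rw [← errSqrt_mul_self, whiteLoss, whitePrec]
    simp only [Matrix.mul_assoc]
  rw [ure, dataOf_sub_const, quad_errSqrt, e1, e2, quad_sandwich (whitePrec_nonneg K h.2)]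

/-- The part of `URE - L^Q` that depends on the hyper-parameter `h`. -/
noncomputable def ureGap (σ : ℝ) (η x : Obs K → ℝ) (h : Hyper) : ℝ :=
  ((r : ℝ) * c)⁻¹ * (2 * (σ ^ 2 * (x ⬝ᵥ ((whiteLoss K * whitePrec K h.2) *ᵥ x)
      - (whiteLoss K * whitePrec K h.2).trace)
    + σ * (x ⬝ᵥ ((whiteLoss K * whitePrec K h.2) *ᵥ whiten K η))
    - σ * (h.1 * (x ⬝ᵥ ((whiteLoss K * whitePrec K h.2) *ᵥ whiten K 1)))))

/-- Besides `ureGap`, the difference `URE - L^Q` has only the term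
`(rc)⁻¹ σ² (tr (Q M) - xᵀ M^{1/2} Q M^{1/2} x)`, which does not involve the hyper-parameter. -/
theorem ure_sub_lossQ (σ : ℝ) (η x : Obs K → ℝ) (h : Hyper) :
    ure K σ (dataOf K σ η x) h - lossQ K η (shrink K (dataOf K σ η x) h)
      = ureGap K σ η x h + ((r : ℝ) * c)⁻¹ * (σ ^ 2 * (lossMat K * errCov K).trace
        - σ ^ 2 * (x ⬝ᵥ (whiteLoss K *ᵥ x))) := by
  rw [ure_dataOf, lossQ_dataOf, ureGap]
  set W := whitePrec K h.2
  set T := whiteLoss K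
  set u := whiteResid K σ η x h.1 with hu
  have hT := transpose_eq_of_nonneg (whiteLoss_nonneg K)
  have e1 : x ⬝ᵥ (T *ᵥ (W *ᵥ u)) = σ * (x ⬝ᵥ ((T * W) *ᵥ x)) + x ⬝ᵥ ((T * W) *ᵥ whiten K η)
      - h.1 * (x ⬝ᵥ ((T * W) *ᵥ whiten K 1)) := by
    rw [Matrix.mulVec_mulVec, hu, whiteResid, Matrix.mulVec_sub, Matrix.mulVec_add,
      Matrix.mulVec_smul, Matrix.mulVec_smul, dotProduct_sub, dotProduct_add, dotProduct_smul,
      dotProduct_smul, smul_eq_mul, smul_eq_mul]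
  have e2 : (W *ᵥ u) ⬝ᵥ (T *ᵥ x) = x ⬝ᵥ (T *ᵥ (W *ᵥ u)) := dotProduct_mulVec_comm hT _ _
  simp only [Matrix.mulVec_sub, Matrix.mulVec_smul, dotProduct_sub, sub_dotProduct,
    smul_dotProduct, dotProduct_smul, smul_eq_mul, e2, e1]
  ring

/-- Under estimability the loss over all cells is the loss `L^Q` over the non-empty cells. -/
theorem loss_shrinkC_eq_lossQ {K : Fin r × Fin c → ℕ} (hK : Estimable K) (μ : ℝ)
    (α : Fin r → ℝ) (β : Fin c → ℝ) (y : Obs K → ℝ) (h : Hyper) :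
    loss (cellMean μ α β) (shrinkC K y h)
      = lossQ K (fun p => cellMean μ α β p) (shrink K y h) := by
  obtain ⟨A, hA⟩ := hK
  set θ : Fin r ⊕ Fin c → ℝ := Sum.elim (fun i => μ + α i) β with hθ
  have h1 : designC r c *ᵥ θ = cellMean μ α β := by
    funext p
    simp [designC, Matrix.mulVec, dotProduct, Fintype.sum_sum_type, hθ, cellMean]
  have h2 : design K *ᵥ θ = fun p : Obs K => cellMean μ α β p := by
    funext p
    rw [← h1]
    rfl
  have h3 : completeMat K *ᵥ (fun p : Obs K => cellMean μ α β p) = cellMean μ α β := by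
    rw [← h2, ← h1, Matrix.mulVec_mulVec, completeMat, ← hA, Matrix.mul_assoc, Matrix.mul_assoc,
      ← Matrix.mul_assoc (design K), (isMoorePenrose_pinv (design K)).mul_mul]
  have h4 : shrinkC K y h - cellMean μ α β
      = completeMat K *ᵥ (shrink K y h - fun p : Obs K => cellMean μ α β p) := by
    rw [Matrix.mulVec_sub, h3, shrinkC]
  rw [loss, lossQ, lossMat, ← Matrix.mulVec_mulVec, Matrix.dotProduct_mulVec,
    Matrix.vecMul_transpose, ← h4]
  simp [dotProduct, sq]

end Identity

/-! ### The operator norm of the loss matrix -/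

section LambdaMax

theorem lambdaMax_nonneg {n : Type*} [Fintype n] [DecidableEq n] {A : Matrix n n ℝ} (hA : 0 ≤ A) :
    0 ≤ lambdaMax A := by
  refine Real.sSup_nonneg fun x hx => ?_
  exact (Matrix.posSemidef_iff_isHermitian_and_spectrum_nonneg.1
    (Matrix.nonneg_iff_posSemidef.1 hA)).2 hx

theorem le_lambdaMax_smul_one {n : Type*} [Fintype n] [DecidableEq n] {A : Matrix n n ℝ}
    (hA : 0 ≤ A) : A ≤ lambdaMax A • (1 : Matrix n n ℝ) := by
  have hH := (Matrix.nonneg_iff_posSemidef.1 hA).1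
  refine Matrix.le_iff.2 (Matrix.posSemidef_iff_isHermitian_and_spectrum_nonneg.2 ⟨?_, ?_⟩)
  · exact (Matrix.isHermitian_one.smul (IsSelfAdjoint.all (lambdaMax A))).sub hH
  · intro x hx
    rw [← Algebra.algebraMap_eq_smul_one, ← spectrum.singleton_sub_eq,
      Set.singleton_sub, Set.mem_image] at hx
    obtain ⟨y, hy, rfl⟩ := hx
    have hb : BddAbove (spectrum ℝ A) := by
      rw [hH.spectrum_real_eq_range_eigenvalues]
      exact (Set.finite_range _).bddAbove
    exact sub_nonneg.2 (le_csSup hb hy)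

variable {r c : ℕ} (K : Fin r × Fin c → ℕ)

/-- The largest eigenvalue of `M^{1/2} Q M^{1/2}` is at most `λ₁(Q) / min K`. -/
theorem whiteLoss_le {k : ℝ} (hk0 : 0 < k) (hk : ∀ p : Obs K, k ≤ K p) :
    whiteLoss K ≤ (lambdaMax (lossMat K) / k) • (1 : Matrix (Obs K) (Obs K) ℝ) := by
  refine le_smul_one (transpose_eq_of_nonneg (whiteLoss_nonneg K)) fun x => ?_
  rw [whiteLoss, ← quad_errSqrt]
  have h := quad_mono (le_lambdaMax_smul_one (lossMat_nonneg K)) (errSqrt K *ᵥ x)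
  rw [Matrix.smul_mulVec, Matrix.one_mulVec, dotProduct_smul, smul_eq_mul] at h
  refine h.trans ?_
  rw [div_mul_eq_mul_div, mul_div_assoc]
  refine mul_le_mul_of_nonneg_left ?_ (lambdaMax_nonneg (lossMat_nonneg K))
  rw [dotProduct, dotProduct, Finset.sum_div]
  refine Finset.sum_le_sum fun p _ => ?_
  rw [errSqrt, Matrix.mulVec_diagonal]
  have hp := hk p
  have h2 : (√(K p : ℝ))⁻¹ * (√(K p : ℝ))⁻¹ ≤ 1 / k := by
    rw [← mul_inv, Real.mul_self_sqrt (by positivity), ← one_div]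
    exact one_div_le_one_div_of_le hk0 hp
  calc _ = (√(K p : ℝ))⁻¹ * (√(K p : ℝ))⁻¹ * (x p * x p) := by ring
    _ ≤ 1 / k * (x p * x p) := mul_le_mul_of_nonneg_right h2 (mul_self_nonneg _)
    _ = _ := by ring

theorem whiten_self_le {k : ℝ} (hk : ∀ p : Obs K, (K p : ℝ) ≤ k) (v : Obs K → ℝ) :
    whiten K v ⬝ᵥ whiten K v ≤ k * ∑ p, v p ^ 2 := by
  rw [dotProduct, Finset.mul_sum]
  refine Finset.sum_le_sum fun p _ => ?_
  have h1 := Real.mul_self_sqrt (show (0 : ℝ) ≤ K p by positivity)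
  calc _ = √(K p : ℝ) * √(K p : ℝ) * v p ^ 2 := by rw [whiten]; ring
    _ ≤ _ := by rw [h1]; exact mul_le_mul_of_nonneg_right (hk p) (sq_nonneg _)

end LambdaMax

/-! ### Risk comparison for a single layout -/

section Risk

variable {r c : ℕ} (K : Fin r × Fin c → ℕ)

theorem measurePreserving_dataOf (σ : ℝ) (η : Fin r × Fin c → ℝ) :
    MeasurePreserving (dataOf K σ fun p => η p) (stdGauss (Obs K)) (obsLaw K σ η) := by
  refine measurePreserving_pi (fun _ => gaussianReal 0 1)
    (fun p : Obs K => gaussianReal (η p) (Real.toNNReal (σ ^ 2 / K p)))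
    (f := fun p t => η p + σ * (√(K p : ℝ))⁻¹ * t) fun p => ⟨by fun_prop, ?_⟩
  have e : (fun t : ℝ => η p + σ * (√(K p : ℝ))⁻¹ * t)
      = (fun t => η p + t) ∘ fun t => σ * (√(K p : ℝ))⁻¹ * t := rfl
  rw [e, ← Measure.map_map (by fun_prop) (by fun_prop), gaussianReal_map_const_mul,
    gaussianReal_map_const_add]
  congr 1
  · simp
  · rw [mul_one]
    apply NNReal.eq
    rw [Real.coe_toNNReal _ (by positivity)]
    change (σ * (√(K p : ℝ))⁻¹) ^ 2 = _
    rw [mul_pow, inv_pow, Real.sq_sqrt (by positivity), div_eq_mul_inv]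

theorem measurable_lossQ_shrink (η : Obs K → ℝ) {hyp : (Obs K → ℝ) → Hyper}
    (hm : Measurable hyp) : Measurable fun y => lossQ K η (shrink K y (hyp y)) := by
  have hP : ∀ i j, Measurable fun y => margPrec K (hyp y).2 i j := fun i j =>
    ((continuous_margPrec K).matrix_elem i j).measurable.comp (measurable_snd.comp hm)
  have h1 : Measurable fun y => (hyp y).1 := measurable_fst.comp hm
  have hS : ∀ p, Measurable fun y => shrink K y (hyp y) p := by
    intro p
    simp only [shrink, Pi.sub_apply, Matrix.mulVec, dotProduct, Matrix.mul_apply]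
    refine (measurable_pi_apply p).sub (Finset.measurable_sum _ fun q _ => ?_)
    exact (Finset.measurable_sum _ fun k _ => (hP k q).const_mul _).mul
      ((measurable_pi_apply q).sub h1)
  simp only [lossQ, Matrix.mulVec, dotProduct, Pi.sub_apply]
  refine Measurable.const_mul (Finset.measurable_sum _ fun p _ => ?_) _
  exact ((hS p).sub_const _).mul (Finset.measurable_sum _ fun q _ =>
    ((hS q).sub_const _).const_mul _)

theorem dotProduct_sub_self_le {n : Type*} [Fintype n] (u v : n → ℝ) :
    (u - v) ⬝ᵥ (u - v) ≤ 2 * (u ⬝ᵥ u) + 2 * (v ⬝ᵥ v) := by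
  have := dotProduct_self_nonneg' (u + v)
  simp only [dotProduct_sub, sub_dotProduct, dotProduct_add, add_dotProduct] at *
  linarith

theorem dotProduct_add_self_le {n : Type*} [Fintype n] (u v : n → ℝ) :
    (u + v) ⬝ᵥ (u + v) ≤ 2 * (u ⬝ᵥ u) + 2 * (v ⬝ᵥ v) := by
  simpa using dotProduct_sub_self_le u (-v)

/-- Every non-empty cell has `K ≥ 1`, so whitening does not shrink the noise. -/
theorem sum_dataOf_sq_le (σ : ℝ) (η x : Obs K → ℝ) :
    ∑ p, dataOf K σ η x p ^ 2 ≤ 2 * (η ⬝ᵥ η) + 2 * σ ^ 2 * (x ⬝ᵥ x) := by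
  simp only [dotProduct, Finset.mul_sum, ← Finset.sum_add_distrib]
  refine Finset.sum_le_sum fun p _ => ?_
  have h1 : (√(K p : ℝ))⁻¹ ^ 2 ≤ 1 := by
    rw [inv_pow, Real.sq_sqrt (by positivity)]
    exact inv_le_one_of_one_le₀ (by exact_mod_cast p.2)
  have h2 : (σ * (√(K p : ℝ))⁻¹ * x p) ^ 2 ≤ σ ^ 2 * (x p * x p) := by
    calc _ = (√(K p : ℝ))⁻¹ ^ 2 * (σ ^ 2 * x p ^ 2) := by ring
      _ ≤ 1 * (σ ^ 2 * x p ^ 2) := mul_le_mul_of_nonneg_right h1 (by positivity)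
      _ = _ := by ring
  rw [dataOf]
  nlinarith [sq_nonneg (η p - σ * (√(K p : ℝ))⁻¹ * x p)]

theorem integrable_dotProduct_self {n : Type*} [Fintype n] :
    Integrable (fun x : n → ℝ => x ⬝ᵥ x) (stdGauss n) := by
  classical
  simpa using integrable_quad (1 : Matrix n n ℝ)

theorem integral_dotProduct_self {n : Type*} [Fintype n] :
    ∫ x : n → ℝ, x ⬝ᵥ x ∂stdGauss n = Fintype.card n := by
  classical
  simpa using integral_quad (1 : Matrix n n ℝ)

theorem lossQ_nonneg (η x : Obs K → ℝ) : 0 ≤ lossQ K η x :=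
  mul_nonneg (by positivity) (quad_nonneg (lossMat_nonneg K) _)

variable {K}

/-- The location parameter stays in the range of the non-extreme quantiles, so the loss is
dominated by a quadratic function of the noise. -/
theorem IsTuning.integrable_lossQ {τ : ℝ} (hτ : τ ∈ Set.Ioc (0 : ℝ) 1)
    {obj : (Obs K → ℝ) → Hyper → ℝ} {hyp : (Obs K → ℝ) → Hyper} (ht : IsTuning τ obj hyp)
    (σ : ℝ) (η : Obs K → ℝ) :
    Integrable (fun x => lossQ K η (shrink K (dataOf K σ η x) (hyp (dataOf K σ η x))))
      (stdGauss (Obs K)) := by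
  set T := whiteLoss K with hT
  set k := 2 / (τ * Fintype.card (Obs K)) with hk
  have hk0 : 0 ≤ k := div_nonneg zero_le_two (mul_nonneg hτ.1.le (by positivity))
  set wη := whiten K η ⬝ᵥ whiten K η with hwη
  set w1 := whiten K 1 ⬝ᵥ whiten K 1 with hw1
  have hw10 : 0 ≤ w1 := dotProduct_self_nonneg' _
  have hdata : Measurable (dataOf K σ η) := measurable_pi_lambda _ fun p => by
    unfold dataOf; fun_prop
  have hdom : Integrable (fun x : Obs K → ℝ => ((r : ℝ) * c)⁻¹ * (lambdaMax T *
      (2 * (σ ^ 2 * (x ⬝ᵥ x)) + 2 * (4 * (σ ^ 2 * (x ⬝ᵥ x)) + 4 * wη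
        + 2 * (k * (2 * (η ⬝ᵥ η) + 2 * σ ^ 2 * (x ⬝ᵥ x)) * w1))))) (stdGauss (Obs K)) := by
    have i0 := integrable_dotProduct_self (n := Obs K)
    refine Integrable.const_mul (Integrable.const_mul ?_ _) _
    refine ((i0.const_mul _).const_mul _).add (Integrable.const_mul ?_ _)
    refine (((i0.const_mul _).const_mul _).add (integrable_const _)).add (Integrable.const_mul ?_ _)
    exact ((((integrable_const _).add (i0.const_mul _)).const_mul _).mul_const _)
  refine hdom.mono' ((measurable_lossQ_shrink K η ht.measurable).comp hdata).aestronglyMeasurable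
    (Eventually.of_forall fun x => ?_)
  rw [Real.norm_of_nonneg (lossQ_nonneg K _ _), lossQ_dataOf]
  set h := hyp (dataOf K σ η x) with hh
  set u := whiteResid K σ η x h.1 with hu
  refine mul_le_mul_of_nonneg_left ?_ (by positivity)
  have h1 := quad_mono (le_lambdaMax_smul_one (whiteLoss_nonneg K))
    (σ • x - whitePrec K h.2 *ᵥ u)
  rw [Matrix.smul_mulVec, Matrix.one_mulVec, dotProduct_smul, smul_eq_mul] at h1
  refine h1.trans (mul_le_mul_of_nonneg_left ?_ (lambdaMax_nonneg (whiteLoss_nonneg K)))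
  have h2 := dotProduct_sub_self_le (σ • x) (whitePrec K h.2 *ᵥ u)
  have h3 := opBound_of_le_smul_one (whitePrec_nonneg K h.2)
    (le_smul_one_of_le_one (whitePrec_le_one K h.2)) u
  have h4 := dotProduct_sub_self_le (σ • x + whiten K η) (h.1 • whiten K 1)
  have h5 := dotProduct_add_self_le (σ • x) (whiten K η)
  have h6 := (hyperRange_sq_le hτ (ht.mem (dataOf K σ η x))).trans
    (mul_le_mul_of_nonneg_left (sum_dataOf_sq_le K σ η x) hk0)
  have h7 := mul_le_mul_of_nonneg_right h6 hw10
  rw [← whiteResid, ← hu] at h4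
  simp only [smul_dotProduct, dotProduct_smul, smul_eq_mul] at h2 h4 h5
  rw [← hh] at h7
  rw [← hwη] at h5
  rw [← hw1] at h4
  nlinarith

/-- A bound, uniform in the hyper-parameter, for the gap between the unbiased risk estimate and
the loss. -/
theorem abs_ureGap_le {J : ℕ} {lo hi : Fin J → Matrix (Obs K) (Obs K) ℝ} {t lam τ σ : ℝ}
    (hb : IsBracketing (whitePrec K) lo hi t) (hlam : 0 ≤ lam)
    (hT1 : whiteLoss K ≤ lam • (1 : Matrix (Obs K) (Obs K) ℝ)) (hσ : 0 ≤ σ)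
    (hτ : τ ∈ Set.Ioc (0 : ℝ) 1) (η x : Obs K → ℝ) {h : Hyper}
    (hh : h ∈ hyperRange τ (dataOf K σ η x)) :
    |ureGap K σ η x h| ≤ ((r : ℝ) * c)⁻¹ * (2 * (
      σ ^ 2 * quadEnvelope (whiteLoss K) lo hi lam t x
      + σ * √(linEnvelope (whiteLoss K) lo hi lam t (whiten K η) x)
      + σ * √(2 / (τ * Fintype.card (Obs K)) * (2 * (η ⬝ᵥ η) + 2 * σ ^ 2 * (x ⬝ᵥ x))
          * linEnvelope (whiteLoss K) lo hi lam t (whiten K 1) x))) := by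
  have hT := whiteLoss_nonneg K
  have b1 := abs_quad_le_quadEnvelope hb hlam hT hT1 h.2 x
  have b2 := Real.abs_le_sqrt
    (sq_bilin_le_linEnvelope hb hT hT1 (whitePrec_nonneg K) h.2 (whiten K η) x)
  have hk0 : 0 ≤ 2 / (τ * Fintype.card (Obs K)) :=
    div_nonneg zero_le_two (mul_nonneg hτ.1.le (by positivity))
  have b3 := Real.abs_le_sqrt (x := h.1 * (x ⬝ᵥ ((whiteLoss K * whitePrec K h.2) *ᵥ whiten K 1)))
    (y := 2 / (τ * Fintype.card (Obs K)) * (2 * (η ⬝ᵥ η) + 2 * σ ^ 2 * (x ⬝ᵥ x))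
          * linEnvelope (whiteLoss K) lo hi lam t (whiten K 1) x) (by
    have h1 := (hyperRange_sq_le hτ hh).trans
      (mul_le_mul_of_nonneg_left (sum_dataOf_sq_le K σ η x) hk0)
    rw [mul_pow]
    exact mul_le_mul h1 (sq_bilin_le_linEnvelope hb hT hT1 (whitePrec_nonneg K) h.2 _ x)
      (sq_nonneg _) ((sq_nonneg _).trans h1))
  rw [ureGap, abs_mul, abs_of_nonneg (by positivity : 0 ≤ ((r : ℝ) * c)⁻¹)]
  refine mul_le_mul_of_nonneg_left ?_ (by positivity)
  rw [abs_mul, abs_of_pos (zero_lt_two' ℝ)]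
  refine mul_le_mul_of_nonneg_left ?_ zero_le_two
  refine (abs_sub _ _).trans (add_le_add ((abs_add_le _ _).trans (add_le_add ?_ ?_)) ?_)
  · rw [abs_mul, abs_of_nonneg (sq_nonneg σ)]
    exact mul_le_mul_of_nonneg_left b1 (sq_nonneg σ)
  · rw [abs_mul, abs_of_nonneg hσ]
    exact mul_le_mul_of_nonneg_left b2 hσ
  · rw [abs_mul, abs_of_nonneg hσ]
    exact mul_le_mul_of_nonneg_left b3 hσ

/-- The risks of the two tuned estimators differ by at most twice the expected envelope of the
gap: the part of `URE - L^Q` that does not depend on the hyper-parameter cancels. -/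
theorem abs_risk_sub_le {τ σ : ℝ} (hτ : τ ∈ Set.Ioc (0 : ℝ) 1) (η : Fin r × Fin c → ℝ)
    {hU hO : (Obs K → ℝ) → Hyper} (hURE : IsURETuning K σ τ hU)
    (hOr : IsOracleTuning K τ η hO) {S : (Obs K → ℝ) → ℝ} (hS : Integrable S (stdGauss (Obs K)))
    (hgap : ∀ x, ∀ h ∈ hyperRange τ (dataOf K σ (fun p => η p) x),
      |ureGap K σ (fun p => η p) x h| ≤ S x) :
    |(∫ x, lossQ K (fun p => η p) (shrink K (dataOf K σ (fun p => η p) x)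
          (hU (dataOf K σ (fun p => η p) x))) ∂stdGauss (Obs K))
      - ∫ x, lossQ K (fun p => η p) (shrink K (dataOf K σ (fun p => η p) x)
          (hO (dataOf K σ (fun p => η p) x))) ∂stdGauss (Obs K)|
      ≤ 2 * ∫ x, S x ∂stdGauss (Obs K) := by
  set e : Obs K → ℝ := fun p => η p
  have iU := IsTuning.integrable_lossQ hτ hURE σ e
  have iO := IsTuning.integrable_lossQ hτ hOr σ e
  rw [← integral_sub iU iO, ← integral_const_mul, abs_of_nonneg]
  · refine integral_mono (iU.sub iO) (hS.const_mul 2) fun x => ?_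
    set y := dataOf K σ e x
    have h1 : ure K σ y (hU y) ≤ ure K σ y (hO y) := hURE.isMinOn y (hOr.mem y)
    have h2 := ure_sub_lossQ K σ e x (hU y)
    have h3 := ure_sub_lossQ K σ e x (hO y)
    have h4 := (abs_le.1 (hgap x _ (hURE.mem y))).1
    have h5 := (abs_le.1 (hgap x _ (hOr.mem y))).2
    change lossQ K e (shrink K y (hU y)) - lossQ K e (shrink K y (hO y)) ≤ 2 * S x
    linarith
  · refine integral_nonneg fun x => sub_nonneg.2 ?_
    exact hOr.isMinOn _ (hURE.mem _)

/-- The quantitative comparison of the risks. The number `J` of brackets is free, and `ψ` bounds the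
sum, divided by `rc`, of `J`, the width of the brackets and the root mean square fluctuation of the
bracketing forms. -/
theorem abs_risk_sub_le_explicit {τ σ C : ℝ} (hτ : τ ∈ Set.Ioc (0 : ℝ) 1) (hσ : 0 ≤ σ)
    (hr : 0 < r) (hc : 0 < c) (η : Fin r × Fin c → ℝ)
    (hη : ((r : ℝ) * c)⁻¹ * ∑ p, η p ^ 2 ≤ C)
    {hU hO : (Obs K → ℝ) → Hyper} (hURE : IsURETuning K σ τ hU)
    (hOr : IsOracleTuning K τ η hO) {J : ℕ} (hJ : 0 < J) [Nonempty (Obs K)] {ψ : ℝ}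
    (hψ : J + (Fintype.card (Obs K) / J + min (r : ℝ) c) + √(2 * J * Fintype.card (Obs K))
      ≤ ((r : ℝ) * c) * ψ) :
    |(∫ x, lossQ K (fun p => η p) (shrink K (dataOf K σ (fun p => η p) x)
          (hU (dataOf K σ (fun p => η p) x))) ∂stdGauss (Obs K))
      - ∫ x, lossQ K (fun p => η p) (shrink K (dataOf K σ (fun p => η p) x)
          (hO (dataOf K σ (fun p => η p) x))) ∂stdGauss (Obs K)|
      ≤ imbalance K * lambdaMax (lossMat K) *
        (8 * σ ^ 2 * ψ + 4 * σ * (√(2 * C) + √(8 * (C + σ ^ 2) / τ)) * √ψ) := by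
  set N : ℝ := (r : ℝ) * c with hN
  set n : ℝ := (Fintype.card (Obs K) : ℝ) with hn
  set e : Obs K → ℝ := fun p => η p with he
  have hN0 : 0 < N := by positivity
  have hn0 : 0 < n := by rw [hn]; exact_mod_cast Fintype.card_pos
  have hnN : n ≤ N := by
    have h := Fintype.card_subtype_le fun p : Fin r × Fin c => 0 < K p
    rw [Fintype.card_prod, Fintype.card_fin, Fintype.card_fin] at h
    rw [hn, hN]
    exact_mod_cast h
  have hsum : ∑ p, η p ^ 2 ≤ C * N := by
    rwa [inv_mul_le_iff₀ hN0, mul_comm] at hη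
  have hee : e ⬝ᵥ e ≤ C * N := by
    refine le_trans ?_ hsum
    have h : ∑ p : Obs K, η p ^ 2 = ∑ p ∈ Finset.univ.filter (fun p => 0 < K p), η p ^ 2 :=
      (Finset.sum_subtype _ (by simp) fun p => η p ^ 2).symm
    simp only [dotProduct, he, ← sq]
    rw [h]
    exact Finset.sum_le_univ_sum_of_nonneg fun p => sq_nonneg _
  have hC0 : 0 ≤ C := by
    refine le_trans ?_ hη
    have : 0 ≤ ∑ p, η p ^ 2 := Finset.sum_nonneg fun _ _ => sq_nonneg _
    positivity
  -- The extreme cell counts.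
  set kmin : ℝ := ⨅ p : Obs K, (K p : ℝ) with hkmin
  set kmax : ℝ := ⨆ p : Obs K, (K p : ℝ) with hkmax
  have hmin1 : 1 ≤ kmin := le_ciInf fun p => by exact_mod_cast p.2
  have hmin : ∀ p : Obs K, kmin ≤ K p := fun p => ciInf_le (Set.finite_range _).bddBelow p
  have hmax : ∀ p : Obs K, (K p : ℝ) ≤ kmax := fun p =>
    le_ciSup (f := fun p : Obs K => (K p : ℝ)) (Set.finite_range _).bddAbove p
  have hmm : kmin ≤ kmax := (hmin (Classical.arbitrary _)).trans (hmax _)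
  have hmin0 : 0 < kmin := zero_lt_one.trans_le hmin1
  set lam1 := lambdaMax (lossMat K) with hlam1
  have hlam10 : 0 ≤ lam1 := lambdaMax_nonneg (lossMat_nonneg K)
  have hν : imbalance K = kmax / kmin := rfl
  set A := imbalance K * lam1 with hA
  set lam := lam1 / kmin with hlam
  have hlam0 : 0 ≤ lam := by positivity
  have hkmax0 : 0 < kmax := hmin0.trans_le hmm
  have hAeq : A = kmax * lam := by rw [hA, hν, hlam]; ring
  have hA0 : 0 ≤ A := by rw [hAeq]; positivity
  have hlamA : lam ≤ A := by
    rw [hAeq]; exact le_mul_of_one_le_left hlam0 (hmin1.trans hmm)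
  have hkA : kmax * lam ^ 2 ≤ A ^ 2 := by
    rw [hAeq, mul_pow]
    exact mul_le_mul_of_nonneg_right (by nlinarith [hmin1.trans hmm]) (sq_nonneg _)
  -- The brackets.
  set T := whiteLoss K with hTdef
  have hT := whiteLoss_nonneg K
  have hT1 := whiteLoss_le K hmin0 hmin
  obtain ⟨lo, hi, hb⟩ := exists_isBracketing_whitePrec K hJ
  set t : ℝ := Fintype.card (Obs K) / J + min (r : ℝ) c with ht
  set R := √(2 * (J : ℝ) * Fintype.card (Obs K)) with hR
  have ht0 : 0 ≤ t := by positivity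
  have hR0 : 0 ≤ R := Real.sqrt_nonneg _
  have hψ0 : 0 ≤ ψ := by
    have : 0 ≤ N * ψ := le_trans (by positivity) hψ
    exact nonneg_of_mul_nonneg_right this hN0
  -- The expected envelopes.
  set q := quadEnvelope T lo hi lam t with hq
  set f := linEnvelope T lo hi lam t (whiten K e) with hf
  set g := linEnvelope T lo hi lam t (whiten K 1) with hg
  set Y : (Obs K → ℝ) → ℝ := fun x =>
    2 / (τ * Fintype.card (Obs K)) * (2 * (e ⬝ᵥ e) + 2 * σ ^ 2 * (x ⬝ᵥ x)) with hY
  have hτ0 := hτ.1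
  have iq : Integrable q (stdGauss (Obs K)) := integrable_quadEnvelope ht0
  have jf : Integrable f (stdGauss (Obs K)) := integrable_linEnvelope _
  have jg : Integrable g (stdGauss (Obs K)) := integrable_linEnvelope _
  have f0 : ∀ x, 0 ≤ f x := linEnvelope_nonneg ht0 _
  have g0 : ∀ x, 0 ≤ g x := linEnvelope_nonneg ht0 _
  have jx := integrable_dotProduct_self (n := Obs K)
  have jY : Integrable Y (stdGauss (Obs K)) :=
    ((integrable_const _).add (jx.const_mul _)).const_mul _
  have Y0 : ∀ x, 0 ≤ Y x := fun x => by
    have h1 := dotProduct_self_nonneg' x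
    have h2 := dotProduct_self_nonneg' e
    simp only [hY]
    positivity
  have Eq : ∫ x, q x ∂stdGauss (Obs K) ≤ 2 * A * (N * ψ) := by
    refine (hb.integral_quadEnvelope_le ht0 hlam0 hT hT1).trans ?_
    have h1 : t + R ≤ N * ψ := by
      have : (0 : ℝ) ≤ J := by positivity
      linarith
    gcongr
  have hF : J + t + R ≤ N * ψ := hψ
  have hF0 : 0 ≤ J + t + R := by positivity
  have Ef : ∫ x, √(f x) ∂stdGauss (Obs K) ≤ √(2 * C) * √ψ * (N * A) := by
    refine (integral_sqrt_le jf f0).trans ?_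
    have h1 := hb.integral_linEnvelope_le hT hT1 (whiten K e)
    have h2 : whiten K e ⬝ᵥ whiten K e ≤ kmax * (C * N) := by
      refine (whiten_self_le K hmax e).trans (mul_le_mul_of_nonneg_left ?_ hkmax0.le)
      simpa [dotProduct, sq] using hee
    have h3 : ∫ x, f x ∂stdGauss (Obs K) ≤ 2 * C * ψ * (N * A) ^ 2 := by
      calc _ ≤ 2 * (kmax * (C * N)) * lam ^ 2 * (N * ψ) := h1.trans (by gcongr)
        _ = 2 * C * ψ * N ^ 2 * (kmax * lam ^ 2) := by ring
        _ ≤ 2 * C * ψ * N ^ 2 * A ^ 2 := by gcongr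
        _ = _ := by ring
    refine (Real.sqrt_le_sqrt h3).trans (le_of_eq ?_)
    rw [Real.sqrt_mul (by positivity), Real.sqrt_mul (by positivity),
      Real.sqrt_sq (by positivity)]
  have Eg : ∫ x, √(Y x * g x) ∂stdGauss (Obs K)
      ≤ √(8 * (C + σ ^ 2) / τ) * √ψ * (N * A) := by
    refine (integral_sqrt_mul_le jY jg Y0 g0).trans ?_
    have h1 := hb.integral_linEnvelope_le hT hT1 (whiten K 1)
    have h2 : whiten K 1 ⬝ᵥ whiten K 1 ≤ kmax * n := by
      simpa [hn] using whiten_self_le K hmax 1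
    have h3 : ∫ x, g x ∂stdGauss (Obs K) ≤ 2 * (kmax * n) * lam ^ 2 * (N * ψ) :=
      h1.trans (by gcongr)
    have h4 : ∫ x, Y x ∂stdGauss (Obs K) ≤ 2 / (τ * n) * (2 * ((C + σ ^ 2) * N)) := by
      rw [integral_const_mul, integral_add (integrable_const _) (jx.const_mul _), integral_const,
        integral_const_mul, integral_dotProduct_self, probReal_univ, one_smul]
      refine mul_le_mul_of_nonneg_left ?_ (by positivity)
      have : σ ^ 2 * n ≤ σ ^ 2 * N := by gcongr
      linarith
    have h5 : (∫ x, Y x ∂stdGauss (Obs K)) * ∫ x, g x ∂stdGauss (Obs K)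
        ≤ 8 * (C + σ ^ 2) / τ * ψ * (N * A) ^ 2 := by
      calc _ ≤ (2 / (τ * n) * (2 * ((C + σ ^ 2) * N))) *
            (2 * (kmax * n) * lam ^ 2 * (N * ψ)) :=
            mul_le_mul h4 h3 (integral_nonneg g0) (by positivity)
        _ = 8 * (C + σ ^ 2) / τ * ψ * N ^ 2 * (kmax * lam ^ 2) := by field_simp; ring
        _ ≤ 8 * (C + σ ^ 2) / τ * ψ * N ^ 2 * A ^ 2 := by gcongr
        _ = _ := by ring
    refine (Real.sqrt_le_sqrt h5).trans (le_of_eq ?_)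
    rw [Real.sqrt_mul (by positivity), Real.sqrt_mul (by positivity),
      Real.sqrt_sq (by positivity)]
  have jsf := integrable_sqrt_of_nonneg jf f0
  have jsg := integrable_sqrt_mul jY jg Y0 g0
  have j1 := (iq.const_mul (σ ^ 2)).add (jsf.const_mul σ)
  have j2 := j1.add (jsg.const_mul σ)
  refine (abs_risk_sub_le hτ η hURE hOr ((j2.const_mul 2).const_mul N⁻¹) fun x h hh =>
    abs_ureGap_le hb hlam0 hT1 hσ hτ e x hh).trans ?_
  have e1 : ∫ x, ((fun x => σ ^ 2 * q x) + fun x => σ * √(f x)) x ∂stdGauss (Obs K)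
      = σ ^ 2 * ∫ x, q x ∂stdGauss (Obs K) + σ * ∫ x, √(f x) ∂stdGauss (Obs K) := by
    rw [← integral_const_mul, ← integral_const_mul]
    exact integral_add (iq.const_mul (σ ^ 2)) (jsf.const_mul σ)
  rw [integral_const_mul, integral_const_mul]
  have e2 := integral_add j1 (jsg.const_mul σ)
  rw [e1, integral_const_mul] at e2
  have hN1 : N⁻¹ * N = 1 := inv_mul_cancel₀ hN0.ne'
  calc _ = 2 * (N⁻¹ * (2 * (σ ^ 2 * ∫ x, q x ∂stdGauss (Obs K)
        + σ * ∫ x, √(f x) ∂stdGauss (Obs K)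
        + σ * ∫ x, √(Y x * g x) ∂stdGauss (Obs K)))) := by rw [← e2]; rfl
    _ ≤ 2 * (N⁻¹ * (2 * (σ ^ 2 * (2 * A * (N * ψ)) + σ * (√(2 * C) * √ψ * (N * A))
        + σ * (√(8 * (C + σ ^ 2) / τ) * √ψ * (N * A))))) := by gcongr
    _ = (N⁻¹ * N) * (A * (8 * σ ^ 2 * ψ
        + 4 * σ * (√(2 * C) + √(8 * (C + σ ^ 2) / τ)) * √ψ)) := by ring
    _ = _ := by rw [hN1, one_mul]

end Risk

/-! ### Asymptotics -/

section Asymptotics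

variable {r c : ℕ} {K : Fin r × Fin c → ℕ}

theorem nonempty_obs_of_estimable (hK : Estimable K) (hr : 0 < r) (hc : 0 < c) :
    Nonempty (Obs K) := by
  by_contra hne
  rw [not_nonempty_iff] at hne
  obtain ⟨A, hA⟩ := hK
  have h := congrFun (congrFun hA (⟨0, hr⟩, ⟨0, hc⟩)) (Sum.inl ⟨0, hr⟩)
  simp [Matrix.mul_apply, designC] at h

theorem imbalance_nonneg (K : Fin r × Fin c → ℕ) : 0 ≤ imbalance K :=
  div_nonneg (Real.iSup_nonneg fun _ => by positivity) (Real.iInf_nonneg fun _ => by positivity)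

theorem integrable_loss_shrinkC (hK : Estimable K) {τ : ℝ} (hτ : τ ∈ Set.Ioc (0 : ℝ) 1)
    {obj : (Obs K → ℝ) → Hyper → ℝ} {hyp : (Obs K → ℝ) → Hyper} (ht : IsTuning τ obj hyp)
    (σ μ : ℝ) (α : Fin r → ℝ) (β : Fin c → ℝ) :
    Integrable (fun y => loss (cellMean μ α β) (shrinkC K y (hyp y)))
      (obsLaw K σ (cellMean μ α β)) := by
  simp only [loss_shrinkC_eq_lossQ hK]
  exact ((measurePreserving_dataOf K σ (cellMean μ α β)).integrable_comp
    (measurable_lossQ_shrink K _ ht.measurable).aestronglyMeasurable).1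
    (ht.integrable_lossQ hτ σ _)

theorem integral_loss_shrinkC (hK : Estimable K) {τ : ℝ}
    {obj : (Obs K → ℝ) → Hyper → ℝ} {hyp : (Obs K → ℝ) → Hyper} (ht : IsTuning τ obj hyp)
    (σ μ : ℝ) (α : Fin r → ℝ) (β : Fin c → ℝ) :
    ∫ y, loss (cellMean μ α β) (shrinkC K y (hyp y)) ∂obsLaw K σ (cellMean μ α β)
      = ∫ x, lossQ K (fun p => cellMean μ α β p)
          (shrink K (dataOf K σ (fun p => cellMean μ α β p) x)
            (hyp (dataOf K σ (fun p => cellMean μ α β p) x))) ∂stdGauss (Obs K) := by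
  simp only [loss_shrinkC_eq_lossQ hK]
  have mp := measurePreserving_dataOf K σ (cellMean μ α β)
  rw [← mp.map_eq]
  exact integral_map mp.measurable.aemeasurable
    (measurable_lossQ_shrink K _ ht.measurable).aestronglyMeasurable

/-- With about `(rc)^{1/4}` brackets, all the error terms are of order `(rc)^{3/4}`. -/
theorem bracket_budget (hr : 0 < r) (hc : 0 < c) {s n : ℝ} (hs : 1 ≤ s)
    (hN : (r : ℝ) * c = s ^ 4) (hn0 : 0 ≤ n) (hn : n ≤ (r : ℝ) * c) :
    (⌈s⌉₊ : ℝ) + (n / ⌈s⌉₊ + min (r : ℝ) c) + √(2 * ⌈s⌉₊ * n) ≤ ((r : ℝ) * c) * (6 / s) := by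
  have hs0 : 0 < s := by linarith
  have h1 : s ≤ ⌈s⌉₊ := Nat.le_ceil s
  have h2 : (⌈s⌉₊ : ℝ) ≤ 2 * s := by
    have := Nat.ceil_lt_add_one hs0.le
    linarith
  have h3 : s ^ 1 ≤ s ^ 3 := pow_le_pow_right₀ hs (by norm_num)
  have h4 : s ^ 2 ≤ s ^ 3 := pow_le_pow_right₀ hs (by norm_num)
  have b1 : n / ⌈s⌉₊ ≤ s ^ 3 := by
    rw [div_le_iff₀ (hs0.trans_le h1)]
    calc n ≤ s ^ 3 * s := by rw [← pow_succ, ← hN]; exact hn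
      _ ≤ _ := by gcongr
  have b2 : min (r : ℝ) c ≤ s ^ 2 := by
    have hr' : (0 : ℝ) < r := by exact_mod_cast hr
    have hc' : (0 : ℝ) < c := by exact_mod_cast hc
    refine le_of_sq_le_sq ?_ (by positivity)
    calc min (r : ℝ) c ^ 2 = min (r : ℝ) c * min (r : ℝ) c := sq _
      _ ≤ r * c := mul_le_mul (min_le_left _ _) (min_le_right _ _) (by positivity) hr'.le
      _ = (s ^ 2) ^ 2 := by rw [hN]; ring
  have b3 : √(2 * ⌈s⌉₊ * n) ≤ 2 * s ^ 3 := by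
    refine Real.sqrt_le_iff.2 ⟨by positivity, ?_⟩
    calc 2 * (⌈s⌉₊ : ℝ) * n ≤ 2 * (2 * s) * s ^ 4 := by
          rw [← hN]
          gcongr
      _ = 4 * s ^ 5 := by ring
      _ ≤ 4 * s ^ 6 :=
          mul_le_mul_of_nonneg_left (pow_le_pow_right₀ hs (by norm_num)) (by norm_num)
      _ = _ := by ring
  have e : ((r : ℝ) * c) * (6 / s) = 6 * s ^ 3 := by rw [hN]; field_simp
  rw [e]
  linarith

/-- The constant in `abs_risk_sub_le_rate`. -/
noncomputable def riskConst (σ C τ : ℝ) : ℝ :=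
  48 * σ ^ 2 + 4 * σ * (√(2 * C) + √(8 * (C + σ ^ 2) / τ)) * √6

theorem riskConst_nonneg {σ : ℝ} (hσ : 0 ≤ σ) (C τ : ℝ) : 0 ≤ riskConst σ C τ := by
  unfold riskConst
  positivity

/-- The two risks differ by at most a constant times `(rc)^{-1/8} ν λ₁(Q)`. -/
theorem abs_risk_sub_le_rate (hK : Estimable K) {τ σ C : ℝ} (hτ : τ ∈ Set.Ioc (0 : ℝ) 1)
    (hσ : 0 ≤ σ) (hr : 0 < r) (hc : 0 < c) (μ : ℝ) (α : Fin r → ℝ) (β : Fin c → ℝ)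
    (hη : ((r : ℝ) * c)⁻¹ * ∑ p, cellMean μ α β p ^ 2 ≤ C)
    {hU hO : (Obs K → ℝ) → Hyper} (hURE : IsURETuning K σ τ hU)
    (hOr : IsOracleTuning K τ (cellMean μ α β) hO) :
    |(∫ y, loss (cellMean μ α β) (shrinkC K y (hU y)) ∂obsLaw K σ (cellMean μ α β))
      - ∫ y, loss (cellMean μ α β) (shrinkC K y (hO y)) ∂obsLaw K σ (cellMean μ α β)|
      ≤ riskConst σ C τ *
        (((r : ℝ) * c) ^ (-(1 / 8) : ℝ) * (imbalance K * lambdaMax (lossMat K))) := by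
  have := nonempty_obs_of_estimable hK hr hc
  rw [integral_loss_shrinkC hK hURE, integral_loss_shrinkC hK hOr]
  set N : ℝ := (r : ℝ) * c with hN
  have hN1 : 1 ≤ N := by
    have h : 1 ≤ r * c := Nat.mul_pos hr hc
    rw [hN]
    exact_mod_cast h
  have hN0 : 0 < N := by linarith
  set s : ℝ := N ^ (1 / 4 : ℝ) with hs
  have hs1 : 1 ≤ s := Real.one_le_rpow hN1 (by norm_num)
  have hs4 : N = s ^ 4 := by
    rw [hs, ← Real.rpow_natCast, ← Real.rpow_mul hN0.le]
    norm_num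
  set ρ : ℝ := N ^ (-(1 / 8) : ℝ) with hρ
  have hρ0 : 0 < ρ := Real.rpow_pos_of_pos hN0 _
  have hρ1 : ρ ≤ 1 := Real.rpow_le_one_of_one_le_of_nonpos hN1 (by norm_num)
  have hρs : 6 / s = 6 * ρ ^ 2 := by
    rw [hρ, ← Real.rpow_natCast, ← Real.rpow_mul hN0.le, hs, div_eq_mul_inv,
      ← Real.rpow_neg hN0.le]
    norm_num
  have hcard : (Fintype.card (Obs K) : ℝ) ≤ N := by
    have h := Fintype.card_subtype_le fun p : Fin r × Fin c => 0 < K p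
    rw [Fintype.card_prod, Fintype.card_fin, Fintype.card_fin] at h
    rw [hN]
    exact_mod_cast h
  have hb := abs_risk_sub_le_explicit hτ hσ hr hc (cellMean μ α β) hη hURE hOr
    (J := ⌈s⌉₊) (Nat.ceil_pos.2 (by linarith)) (bracket_budget hr hc hs1 hs4 (by positivity) hcard)
  refine hb.trans ?_
  have hA : 0 ≤ imbalance K * lambdaMax (lossMat K) :=
    mul_nonneg (imbalance_nonneg K) (lambdaMax_nonneg (lossMat_nonneg K))
  have hsq : √(6 / s) = √6 * ρ := by
    rw [hρs, Real.sqrt_mul (by norm_num), Real.sqrt_sq hρ0.le]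
  rw [hsq, hρs, ← mul_assoc (riskConst σ C τ), mul_comm (riskConst σ C τ * ρ)]
  refine mul_le_mul_of_nonneg_left ?_ hA
  have h1 : ρ ^ 2 ≤ ρ := by nlinarith
  have h2 : 8 * σ ^ 2 * (6 * ρ ^ 2) ≤ 48 * σ ^ 2 * ρ := by nlinarith [sq_nonneg σ]
  rw [riskConst]
  linarith

end Asymptotics

end TwoWay

theorem mainTheorem3
    {ι : Type*} (l : Filter ι) (r c : ι → ℕ)
    (hr : Tendsto r l atTop) (hc : Tendsto c l atTop)
    (σ : ℝ) (hσ : 0 < σ) (τ : ℝ) (hτ : τ ∈ Set.Ioc (0 : ℝ) 1)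
    (K : ∀ n, Fin (r n) × Fin (c n) → ℕ)
    (μ : ι → ℝ) (α : ∀ n, Fin (r n) → ℝ) (β : ∀ n, Fin (c n) → ℝ)
    (hEst : ∀ n, TwoWay.Estimable (K n))
    (hA1 : ∃ C : ℝ, ∀ᶠ n in l,
      ((r n : ℝ) * c n)⁻¹ * ∑ p, TwoWay.cellMean (μ n) (α n) (β n) p ^ 2 ≤ C)
    (hA2 : Tendsto (fun n => ((r n : ℝ) * c n) ^ (-(1 / 8) : ℝ) *
      Real.log ((r n : ℝ) * c n) ^ 2 * TwoWay.imbalance (K n) *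
      TwoWay.lambdaMax (TwoWay.lossMat (K n))) l (𝓝 0))
    (hU hO : ∀ n, (TwoWay.Obs (K n) → ℝ) → TwoWay.Hyper)
    (hURE : ∀ n, TwoWay.IsURETuning (K n) σ τ (hU n))
    (hOracle : ∀ n, TwoWay.IsOracleTuning (K n) τ
      (TwoWay.cellMean (μ n) (α n) (β n)) (hO n)) :
    (∀ n, Integrable (fun y => TwoWay.loss (TwoWay.cellMean (μ n) (α n) (β n))
        (TwoWay.shrinkC (K n) y (hU n y)))
      (TwoWay.obsLaw (K n) σ (TwoWay.cellMean (μ n) (α n) (β n)))) ∧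
    (∀ n, Integrable (fun y => TwoWay.loss (TwoWay.cellMean (μ n) (α n) (β n))
        (TwoWay.shrinkC (K n) y (hO n y)))
      (TwoWay.obsLaw (K n) σ (TwoWay.cellMean (μ n) (α n) (β n)))) ∧
    Tendsto (fun n =>
      (∫ y, TwoWay.loss (TwoWay.cellMean (μ n) (α n) (β n))
          (TwoWay.shrinkC (K n) y (hU n y))
        ∂(TwoWay.obsLaw (K n) σ (TwoWay.cellMean (μ n) (α n) (β n)))) -
      ∫ y, TwoWay.loss (TwoWay.cellMean (μ n) (α n) (β n))
          (TwoWay.shrinkC (K n) y (hO n y))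
        ∂(TwoWay.obsLaw (K n) σ (TwoWay.cellMean (μ n) (α n) (β n)))) l (𝓝 0) := by
  refine ⟨fun n => TwoWay.integrable_loss_shrinkC (hEst n) hτ (hURE n) σ _ _ _,
    fun n => TwoWay.integrable_loss_shrinkC (hEst n) hτ (hOracle n) σ _ _ _, ?_⟩
  obtain ⟨C, hC⟩ := hA1
  have hlim := hA2.const_mul (TwoWay.riskConst σ C τ)
  rw [mul_zero] at hlim
  refine squeeze_zero_norm' ?_ hlim
  filter_upwards [hC, hr.eventually_ge_atTop 3, hc.eventually_ge_atTop 1] with n hCn hrn hcn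
  have hN : (3 : ℝ) ≤ (r n : ℝ) * c n := by
    have h : 3 * 1 ≤ r n * c n := Nat.mul_le_mul hrn hcn
    exact_mod_cast h
  -- The logarithmic factor in the assumption is at least one.
  have hlog : 1 ≤ Real.log ((r n : ℝ) * c n) ^ 2 := by
    refine one_le_pow₀ ((Real.le_log_iff_exp_le (by linarith)).2 ?_)
    linarith [Real.exp_one_lt_d9]
  refine (TwoWay.abs_risk_sub_le_rate (hEst n) hτ hσ.le (by omega) (by omega) _ _ _ hCn
    (hURE n) (hOracle n)).trans ?_
  refine mul_le_mul_of_nonneg_left ?_ (TwoWay.riskConst_nonneg hσ.le C τ)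
  have hν := TwoWay.imbalance_nonneg (K n)
  have hl := TwoWay.lambdaMax_nonneg (TwoWay.lossMat_nonneg (K n))
  have hρ : 0 ≤ ((r n : ℝ) * c n) ^ (-(1 / 8) : ℝ) := Real.rpow_nonneg (by linarith) _
  rw [← mul_assoc]
  gcongr
  exact le_mul_of_one_le_right hρ hlog
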